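/- Let $\rho_{\max}>0$, let $f:[0,\rho_{\max}]\to[0,\infty)$ be Lipschitz continuous with $f(0)=f(\rho_{\max})=0$, and let $\mathfrak C=(-1,1)$. For $\alpha\ge 0$ put $c_\alpha(\rho)=1+\alpha\rho$. Given a measurable $\bar\rho:\mathbb R\to[0,\rho_{\max}]$ vanishing outside $\mathfrak C$, an entropy solution of the one-dimensional Hughes model with cost parameter $\alpha$ and initial datum $\bar\rho$ is a pair $(\rho,\xi)$, where $\rho\in C^0([0,\infty);L^1(\mathbb R))$ is measurable with values in $[0,\rho_{\max}]$ and $\xi:[0,\infty)\to\mathfrak C$ is Lipschitz continuous, such that $\int_{-1}^{\xi(t)}c_\alpha(\rho(t,y))\,dy=\int_{\xi(t)}^{1}c_\alpha(\rho(t,y))\,dy$ for a.e. $t>0$, $\rho(0,\cdot)=\bar\rho$ a.e., and $$0\le\int_0^\infty\!\!\int_{\mathbb R}\Bigl(|\rho-\kappa|\,\varphi_t+\operatorname{sign}(x-\xi(t))\operatorname{sign}(\rho-\kappa)\,(f(\rho)-f(\kappa))\,\varphi_x\Bigr)dx\,dt+2\int_0^\infty f(\kappa)\,\varphi(t,\xi(t))\,dt$$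 for all $\kappa\in[0,\rho_{\max}]$ and all nonnegative $\varphi\in C_c^\infty((0,\infty)\times\mathbb R)$. It is well-separated if the strong one-sided traces $\rho(t,\xi(t)^\pm)$ exist and equal zero for a.e. $t>0$, that is, $\operatorname{ess\,lim}_{h\to0^+}\int_0^T\rho(t,\xi(t)\pm h)\,dt=0$ for every $T>0$. For $i\in\{1,2\}$ let $(\rho_i,\xi_i)$ be a well-separated entropy solution with cost parameter $\alpha_i\ge0$ and initial datum $\bar\rho_i$. Suppose $\bar\rho_1\in BV(\mathbb R)$. Then for a.e. $t>0$ the quantity $C_1(t):=\sup\{\mathrm{TV}(\rho_1(s,\cdot)):s\in[0,t]\}$, where $\mathrm{TV}$ is the (essential) total variation on $\mathbb R$, is finite, and $$\|\rho_1(t,\cdot)-\rho_2(t,\cdot)\|_{L^1(\mathfrak C)}\le\|\bar\rho_1-\bar\rho_2\|_{L^1(\mathfrak C)}+2\,C_1(t)\Bigl(|\xi_1(0)-\xi_2(0)|+\int_0^t|\dot\xi_1(s)-\dot\xi_2(s)|\,ds\Bigr).$$ -/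

import Mathlib

open MeasureTheory Set Filter
open scoped Topology ContDiff

noncomputable section

namespace Hughes

/-- The corridor `(-1, 1)`. -/
def corridor : Set ℝ := Ioo (-1) 1

/-- The affine cost `c(r) = 1 + α r`. -/
def affineCost (α : ℝ) (r : ℝ) : ℝ := 1 + α * r

/-- Total variation on `ℝ` of (the a.e.-class of) a locally integrable function: the supremum of
`∫ u ψ'` over all `ψ ∈ C_c^∞(ℝ)` with `|ψ| ≤ 1`. -/
def totalVariation (u : ℝ → ℝ) : ENNReal :=
  ⨆ (ψ : ℝ → ℝ) (_ : ContDiff ℝ ∞ ψ) (_ : HasCompactSupport ψ) (_ : ∀ x, |ψ x| ≤ 1),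
    ENNReal.ofReal (∫ x, u x * deriv ψ x)

/-- Membership in `BV(ℝ)`. -/
def IsBV (u : ℝ → ℝ) : Prop :=
  Integrable u ∧ totalVariation u < ⊤

/-- `sup {TV(ρ(s, ·)) : s ∈ [0, t]}`. -/
def supVariation (ρ : ℝ → ℝ → ℝ) (t : ℝ) : ENNReal :=
  ⨆ s ∈ Icc 0 t, totalVariation (ρ s)

/-- An initial density: measurable, with values in `[0, ρmax]`, zero outside the corridor. -/
structure IsInitialDatum (ρmax : ℝ) (ρ₀ : ℝ → ℝ) : Prop where
  measurable : Measurable ρ₀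
  mem_Icc : ∀ x, ρ₀ x ∈ Icc 0 ρmax
  support : ∀ x, x ∉ corridor → ρ₀ x = 0

/-- Nonnegative test functions in `C_c^∞((0, ∞) × ℝ)`. -/
structure IsTestFunction (φ : ℝ × ℝ → ℝ) : Prop where
  smooth : ContDiff ℝ ∞ φ
  compactSupport : HasCompactSupport φ
  tsupport_subset : tsupport φ ⊆ Ioi 0 ×ˢ univ
  nonneg : ∀ p, 0 ≤ φ p

/-- The Kruzhkov entropy flux `sign(x - ξ(t)) sign(r - κ) (f(r) - f(κ))`, where `z = ξ(t)`. -/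
def entropyFlux (f : ℝ → ℝ) (x r κ z : ℝ) : ℝ :=
  Real.sign (x - z) * Real.sign (r - κ) * (f r - f κ)

/-- Entropy solutions `(ρ, ξ)` of the one-dimensional Hughes model (open-end formulation) with
maximal density `ρmax`, flux `f`, cost `c` and initial datum `ρ₀`. Only times `t ≥ 0` matter;
`ρ t` stands for `ρ(t, ·)`. -/
structure IsEntropySolution (ρmax : ℝ) (f c : ℝ → ℝ) (ρ₀ : ℝ → ℝ)
    (ρ : ℝ → ℝ → ℝ) (ξ : ℝ → ℝ) : Prop where
  aemeasurable : AEMeasurable (Function.uncurry ρ) (volume.restrict (Ici 0 ×ˢ univ))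
  mem_Icc : ∀ t, 0 ≤ t → ∀ᵐ x, ρ t x ∈ Icc 0 ρmax
  integrable : ∀ t, 0 ≤ t → Integrable (ρ t)
  /-- `ρ ∈ C([0, ∞); L¹(ℝ))`. -/
  continuous : ∀ t, 0 ≤ t →
    Tendsto (fun s => eLpNorm (ρ s - ρ t) 1 volume) (𝓝[Ici 0] t) (𝓝 0)
  lipschitz : ∃ L, LipschitzOnWith L ξ (Ici 0)
  mem_corridor : ∀ t, 0 ≤ t → ξ t ∈ corridor
  /-- The turning curve balances the cost on both sides. -/
  cost_balance : ∀ᵐ t ∂(volume.restrict (Ioi 0)),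
    ∫ y in (-1)..(ξ t), c (ρ t y) = ∫ y in (ξ t)..1, c (ρ t y)
  initial : ρ 0 =ᵐ[volume] ρ₀
  entropy : ∀ κ ∈ Icc 0 ρmax, ∀ φ : ℝ × ℝ → ℝ, IsTestFunction φ →
    0 ≤ (∫ t in Ioi 0, ∫ x,
          (|ρ t x - κ| * deriv (fun s => φ (s, x)) t
            + entropyFlux f x (ρ t x) κ (ξ t) * deriv (fun y => φ (t, y)) x))
        + 2 * ∫ t in Ioi 0, f κ * φ (t, ξ t)

/-- `γ` is the strong one-sided trace of `ρ` along the curve `x = ξ(t)`, `t > 0`, from the right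
(`σ = 1`) or from the left (`σ = -1`): for every `T > 0`,
`ess lim_{h → 0+} ∫_0^T |ρ(t, ξ(t) + σ h) - γ(t)| dt = 0`. -/
def HasStrongTrace (ρ : ℝ → ℝ → ℝ) (ξ : ℝ → ℝ) (σ : ℝ) (γ : ℝ → ℝ) : Prop :=
  ∀ T, 0 < T →
    Tendsto (fun h => ∫⁻ t in Ioo 0 T, ENNReal.ofReal |ρ t (ξ t + σ * h) - γ t|)
      (𝓝[>] 0 ⊓ ae volume) (𝓝 0)

/-- Both one-sided traces of `ρ` along the turning curve exist and vanish for a.e. `t > 0`. -/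
def IsWellSeparated (ρ : ℝ → ℝ → ℝ) (ξ : ℝ → ℝ) : Prop :=
  HasStrongTrace ρ ξ 1 (fun _ => 0) ∧ HasStrongTrace ρ ξ (-1) (fun _ => 0)

end Hughes

end

/-! A vanishing trace on both sides of the turning curve decouples those sides. Restrict ρ to x >
ξ(t) or to x < ξ(t) and extend it by zero: the result is a Kruzhkov entropy solution on the whole
line, with flux f on the right and -f on the left (`exists_isKruzhkovSolution_sidePart`). The reason
is that a cutoff of width ε near the curve has gradient of order 1/ε, while zero trace makes the
mass of ρ in that strip o(ε), so the cutoff error disappears; the zero density outside is itself a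
solution.

The resulting equations no longer involve ξ, so solutions with different turning curves are
comparable side by side. Kruzhkov's L¹ contraction, obtained by doubling of variables
(`IsKruzhkovSolution.norm_sub_le`), bounds the distance of the sides at time t by their distance at
time 0. Summed over the two sides, the initial distance exceeds the distance of the data only
through the strip between ξ₁(0) and ξ₂(0), by at most twice the mass of the first datum there. That
mass is at most the strip width times the total variation (`sum_integral_sidePart_sub_le`).

Contraction applied to a side and its spatial translate shows that the L¹ modulus of continuity of
each side does not grow. Initially it is linear in the shift, with the jump at the cut costing at
most ρmax, so the total variation stays bounded uniformly in time
(`totalVariation_le_of_isWellSeparated`).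

The bound so obtained involves only |ξ₁(0) - ξ₂(0)| and the initial variation, so it is stronger
than the stated one. -/

noncomputable section

namespace Hughes

/-! ### Sliding-window integrals of test functions -/

/-- The primitive of `ψ(· - a) - ψ(· - b)`. -/
def windowIntegral (ψ : ℝ → ℝ) (a b x : ℝ) : ℝ := ∫ y in (x - b)..(x - a), ψ y

lemma hasDerivAt_windowIntegral {ψ : ℝ → ℝ} (hψ : Continuous ψ) (a b x : ℝ) :
    HasDerivAt (windowIntegral ψ a b) (ψ (x - a) - ψ (x - b)) x := by
  have key : ∀ c, HasDerivAt (fun x : ℝ => ∫ y in (0 : ℝ)..(x - c), ψ y) (ψ (x - c)) x := by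
    intro c
    have h := intervalIntegral.integral_hasDerivAt_right
      (hψ.intervalIntegrable 0 (x - c)) (hψ.stronglyMeasurableAtFilter _ _) hψ.continuousAt
    simpa [Function.comp_def] using HasDerivAt.comp x h ((hasDerivAt_id x).sub_const c)
  refine ((key a).sub (key b)).congr_of_eventuallyEq (Eventually.of_forall fun y => ?_)
  simp only [windowIntegral, Pi.sub_apply]
  rw [intervalIntegral.integral_interval_sub_left] <;> exact hψ.intervalIntegrable _ _

lemma deriv_windowIntegral {ψ : ℝ → ℝ} (hψ : Continuous ψ) (a b : ℝ) :
    deriv (windowIntegral ψ a b) = fun x => ψ (x - a) - ψ (x - b) :=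
  funext fun x => (hasDerivAt_windowIntegral hψ a b x).deriv

lemma contDiff_windowIntegral {ψ : ℝ → ℝ} (hψ : ContDiff ℝ ∞ ψ) (a b : ℝ) :
    ContDiff ℝ ∞ (windowIntegral ψ a b) := by
  rw [contDiff_infty_iff_deriv, deriv_windowIntegral hψ.continuous]
  exact ⟨fun x => (hasDerivAt_windowIntegral hψ.continuous a b x).differentiableAt, by fun_prop⟩

lemma windowIntegral_eq_zero {ψ : ℝ → ℝ} {r a b x : ℝ} (hψ : ∀ y, r < |y| → ψ y = 0)
    (hx : x < min a b - r ∨ max a b + r < x) : windowIntegral ψ a b x = 0 := by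
  rw [windowIntegral, intervalIntegral.integral_congr (g := fun _ => (0 : ℝ))]
  · simp
  intro y hy
  refine hψ y ?_
  rcases hx with hx | hx
  · have h1 := min_le_left a b
    have h2 := min_le_right a b
    have : y < -r := hy.2.trans_lt (max_lt (by linarith) (by linarith))
    exact lt_abs.2 (Or.inr (by linarith))
  · have h1 := le_max_left a b
    have h2 := le_max_right a b
    have : r < y := (lt_min (by linarith) (by linarith)).trans_le hy.1
    exact lt_abs.2 (Or.inl this)

lemma tsupport_windowIntegral_subset {ψ : ℝ → ℝ} {r a b : ℝ} (hψ : ∀ y, r < |y| → ψ y = 0) :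
    tsupport (windowIntegral ψ a b) ⊆ Icc (min a b - r) (max a b + r) := by
  refine closure_minimal (fun x hx => ?_) isClosed_Icc
  by_contra h
  rw [mem_Icc, not_and_or, not_le, not_le] at h
  exact hx (windowIntegral_eq_zero hψ h)

lemma hasCompactSupport_windowIntegral {ψ : ℝ → ℝ} {r a b : ℝ} (hψ : ∀ y, r < |y| → ψ y = 0) :
    HasCompactSupport (windowIntegral ψ a b) :=
  isCompact_Icc.of_isClosed_subset (isClosed_tsupport _) (tsupport_windowIntegral_subset hψ)

lemma exists_radius_of_hasCompactSupport {ψ : ℝ → ℝ} (hψ : HasCompactSupport ψ) :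
    ∃ r, 0 < r ∧ ∀ y, r < |y| → ψ y = 0 := by
  obtain ⟨r, hr, h⟩ := hψ.isCompact.isBounded.subset_closedBall_lt 0 0
  refine ⟨r, hr, fun y hy => ?_⟩
  by_contra hne
  have := h (subset_tsupport _ hne)
  simp only [mem_closedBall_zero_iff, Real.norm_eq_abs] at this
  linarith

/-! ### Real sign -/

lemma measurable_real_sign : Measurable Real.sign := by
  unfold Real.sign
  exact Measurable.ite measurableSet_Iio measurable_const
    (Measurable.ite measurableSet_Ioi measurable_const measurable_const)

lemma abs_real_sign_le_one (x : ℝ) : |Real.sign x| ≤ 1 := by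
  rcases Real.sign_apply_eq x with h | h | h <;> simp [h]

lemma self_mul_real_sign (x : ℝ) : x * Real.sign x = |x| := by
  rcases lt_trichotomy x 0 with h | h | h
  · rw [Real.sign_of_neg h, abs_of_neg h]; ring
  · simp [h]
  · rw [Real.sign_of_pos h, abs_of_pos h]; ring

/-! ### Duality between `L¹` and test functions -/

/-- A shrinking sequence of bumps centred at zero. -/
def shrinkingBump (n : ℕ) : ContDiffBump (0 : ℝ) :=
  ⟨1 / (n + 1), 2 / (n + 1), by positivity, by gcongr; norm_num⟩

lemma tendsto_shrinkingBump_rOut : Tendsto (fun n => (shrinkingBump n).rOut) atTop (𝓝 0) := by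
  have := (tendsto_one_div_add_atTop_nhds_zero_nat (𝕜 := ℝ)).const_mul 2
  simpa [shrinkingBump, div_eq_mul_inv] using this

/-- Mollification by a bump does not increase the sup norm. -/
lemma abs_convolution_normed_le (φ : ContDiffBump (0 : ℝ)) {s : ℝ → ℝ} {C : ℝ} (x : ℝ)
    (hs : ∀ y, |s y| ≤ C) :
    |convolution (φ.normed volume) s (ContinuousLinearMap.lsmul ℝ ℝ) volume x| ≤ C := by
  rw [convolution_def]
  have h1 : ∫ t, φ.normed volume t * C = C := by
    rw [integral_mul_const, φ.integral_normed, one_mul]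
  rw [← h1, ← Real.norm_eq_abs]
  refine norm_integral_le_of_norm_le (φ.integrable_normed.mul_const C)
    (Eventually.of_forall fun t => ?_)
  simp only [ContinuousLinearMap.lsmul_apply, smul_eq_mul, norm_mul, Real.norm_eq_abs]
  rw [abs_of_nonneg (φ.nonneg_normed t)]
  exact mul_le_mul_of_nonneg_left (hs _) (φ.nonneg_normed t)

/-- The ideal test function is sign g. Cutting it off to a ball and mollifying makes it admissible
without leaving [-1, 1], and dominated convergence recovers the integral over the ball. -/
lemma integral_abs_le_of_forall_test {g : ℝ → ℝ} (hg : Integrable g) {C : ℝ}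
    (h : ∀ ψ : ℝ → ℝ, ContDiff ℝ ∞ ψ → HasCompactSupport ψ → (∀ x, |ψ x| ≤ 1) →
      ∫ x, g x * ψ x ≤ C) :
    ∫ x, |g x| ≤ C := by
  have hball : ∀ n : ℕ, ∫ x in Metric.closedBall 0 (n : ℝ), |g x| ≤ C := by
    intro n
    set B : Set ℝ := Metric.closedBall 0 (n : ℝ)
    have hB : MeasurableSet B := Metric.isClosed_closedBall.measurableSet
    set s : ℝ → ℝ := B.indicator (fun x => Real.sign (g x)) with hs
    have hs1 : ∀ x, |s x| ≤ 1 := by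
      intro x
      by_cases hx : x ∈ B
      · simp [hs, hx, abs_real_sign_le_one]
      · simp [hs, hx]
    have hsint : Integrable s := by
      have hm : AEStronglyMeasurable s volume :=
        ((measurable_real_sign.comp_aemeasurable hg.aemeasurable).indicator
          hB).aestronglyMeasurable
      have hi : Integrable (B.indicator (fun _ => (1 : ℝ))) :=
        (integrable_indicator_iff hB).2 (integrableOn_const (by
          exact (isCompact_closedBall (0 : ℝ) n).measure_lt_top.ne))
      refine hi.mono hm (Eventually.of_forall fun x => ?_)
      by_cases hx : x ∈ B
      · simp [hs, hx, abs_real_sign_le_one]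
      · simp [hs, hx]
    have hscs : HasCompactSupport s :=
      HasCompactSupport.of_support_subset_isCompact (isCompact_closedBall (0 : ℝ) n)
        (support_indicator_subset)
    set ψ : ℕ → ℝ → ℝ := fun m =>
      convolution ((shrinkingBump m).normed volume) s (ContinuousLinearMap.lsmul ℝ ℝ) volume
    have hconv : ∀ᵐ x, Tendsto (fun m => ψ m x) atTop (𝓝 (s x)) :=
      ContDiffBump.ae_convolution_tendsto_right_of_locallyIntegrable (K := 2)
        tendsto_shrinkingBump_rOut
        (Eventually.of_forall fun m => by simp [shrinkingBump, div_eq_mul_inv])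
        hsint.locallyIntegrable
    have hψ1 : ∀ m x, |ψ m x| ≤ 1 := fun m x => abs_convolution_normed_le _ x hs1
    have hψs : ∀ m, ContDiff ℝ ∞ (ψ m) := fun m =>
      HasCompactSupport.contDiff_convolution_left _ (shrinkingBump m).hasCompactSupport_normed
        (shrinkingBump m).contDiff_normed hsint.locallyIntegrable
    have hψc : ∀ m, HasCompactSupport (ψ m) := fun m =>
      HasCompactSupport.convolution _ (shrinkingBump m).hasCompactSupport_normed hscs
    have hlim : Tendsto (fun m => ∫ x, g x * ψ m x) atTop (𝓝 (∫ x, g x * s x)) := by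
      refine tendsto_integral_of_dominated_convergence (fun x => |g x|)
        (fun m => hg.1.mul (hψs m).continuous.aestronglyMeasurable) hg.abs
        (fun m => Eventually.of_forall fun x => ?_) ?_
      · rw [Real.norm_eq_abs, abs_mul]
        exact mul_le_of_le_one_right (abs_nonneg _) (hψ1 m x)
      · filter_upwards [hconv] with x hx using hx.const_mul _
    have hfin : ∫ x, g x * s x ≤ C :=
      le_of_tendsto hlim (Eventually.of_forall fun m => h _ (hψs m) (hψc m) (hψ1 m))
    calc ∫ x in B, |g x| = ∫ x, B.indicator (fun x => |g x|) x := (integral_indicator hB).symm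
      _ = ∫ x, g x * s x := by
        congr 1; ext x
        by_cases hx : x ∈ B
        · simp [hs, hx, self_mul_real_sign]
        · simp [hs, hx]
      _ ≤ C := hfin
  have hcov : AECover (volume : Measure ℝ) atTop
      (fun n : ℕ => Metric.closedBall (0 : ℝ) (n : ℝ)) :=
    aecover_closedBall tendsto_natCast_atTop_atTop
  exact le_of_tendsto (hcov.integral_tendsto_of_countably_generated hg.abs)
    (Eventually.of_forall hball)

/-! ### Total variation and translations -/

lemma integral_mul_deriv_le_of_totalVariation {u : ℝ → ℝ} (hTV : totalVariation u < ⊤)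
    {Ψ : ℝ → ℝ} {c : ℝ} (hc : 0 < c) (hΨ : ContDiff ℝ ∞ Ψ) (hcs : HasCompactSupport Ψ)
    (hb : ∀ x, |Ψ x| ≤ c) :
    ∫ x, u x * deriv Ψ x ≤ c * (totalVariation u).toReal := by
  have h1 : ENNReal.ofReal (∫ x, u x * deriv (fun y => c⁻¹ * Ψ y) x) ≤ totalVariation u := by
    refine le_iSup₂_of_le (fun y => c⁻¹ * Ψ y) (by fun_prop)
      (le_iSup₂_of_le (hcs.mul_left) ?_ le_rfl)
    intro x
    rw [abs_mul, abs_of_pos (inv_pos.2 hc), inv_mul_le_iff₀ hc, mul_one]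
    exact hb x
  have h2 : ∫ x, u x * deriv (fun y => c⁻¹ * Ψ y) x = c⁻¹ * ∫ x, u x * deriv Ψ x := by
    rw [← integral_const_mul]
    congr 1; ext x
    rw [deriv_const_mul_field]; ring
  rw [h2] at h1
  have h3 := (ENNReal.ofReal_le_iff_le_toReal hTV.ne).1 h1
  rwa [inv_mul_le_iff₀ hc] at h3

/-- By duality the shift moves onto the test function, and ψ(x - h) - ψ(x) is the derivative of a
window integral over a window of length |h|, hence of a test function bounded by |h|. -/
lemma integral_abs_translate_sub_le {u : ℝ → ℝ} (hu : IsBV u) (h : ℝ) :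
    ∫ x, |u (x + h) - u x| ≤ |h| * (totalVariation u).toReal := by
  rcases eq_or_ne h 0 with rfl | hh
  · simp
  have hui := hu.1
  refine integral_abs_le_of_forall_test ((hui.comp_add_right h).sub hui) fun ψ hψ hc hb => ?_
  obtain ⟨r, -, hr⟩ := exists_radius_of_hasCompactSupport hc
  have hbdd : ∀ {v : ℝ → ℝ} (c : ℝ), Integrable v → Integrable fun x => v x * ψ (x - c) := by
    intro v c hv
    refine hv.mul_bdd (c := 1) (by fun_prop) (Eventually.of_forall fun x => hb _)
  have hbdd0 : ∀ {v : ℝ → ℝ}, Integrable v → Integrable fun x => v x * ψ x := fun hv => by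
    simpa using hbdd 0 hv
  have e1 : ∫ x, u (x + h) * ψ x = ∫ x, u x * ψ (x - h) := by
    rw [← integral_add_right_eq_self (fun x => u x * ψ (x - h)) h]
    simp
  have e2 : ∫ x, (u (x + h) - u x) * ψ x = ∫ x, u x * deriv (windowIntegral ψ h 0) x := by
    simp_rw [sub_mul, deriv_windowIntegral hψ.continuous, mul_sub, sub_zero]
    rw [integral_sub (hbdd0 (hui.comp_add_right h)) (hbdd0 hui), e1,
      integral_sub (hbdd h hui) (hbdd0 hui)]
  refine e2.trans_le ?_
  refine integral_mul_deriv_le_of_totalVariation hu.2 (abs_pos.2 hh)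
    (contDiff_windowIntegral hψ _ _) (hasCompactSupport_windowIntegral hr) fun x => ?_
  have := intervalIntegral.norm_integral_le_of_norm_le_const (a := x - 0) (b := x - h) (f := ψ)
    (C := 1) (fun y _ => hb y)
  simpa [windowIntegral] using this

/-- Converse of the translation estimate: replace ψ' by difference quotients, transfer them to u,
and pass to the limit with the dominating function |u| times the Lipschitz constant of ψ. -/
lemma totalVariation_le_of_translate {u : ℝ → ℝ} (hu : Integrable u) {C : ℝ}
    (h : ∀ h, 0 < h → ∫ x, |u (x + h) - u x| ≤ C * h) :
    totalVariation u ≤ ENNReal.ofReal C := by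
  refine iSup₂_le fun ψ hψ => iSup₂_le fun hc hb => ENNReal.ofReal_le_ofReal ?_
  obtain ⟨L, hL⟩ := (hψ.of_le (by norm_num : (1 : WithTop ℕ∞) ≤ ∞)).lipschitzWith_of_hasCompactSupport hc
    one_ne_zero
  have hseq : Tendsto (fun n : ℕ => (1 : ℝ) / (n + 1)) atTop (𝓝[≠] 0) :=
    tendsto_nhdsWithin_iff.2 ⟨tendsto_one_div_add_atTop_nhds_zero_nat,
      Eventually.of_forall fun n => by simp; positivity⟩
  have hlim : Tendsto (fun n : ℕ => ∫ x, u x *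
      (((1 : ℝ) / (n + 1))⁻¹ * (ψ (x + 1 / (n + 1)) - ψ x))) atTop
      (𝓝 (∫ x, u x * deriv ψ x)) := by
    refine tendsto_integral_of_dominated_convergence (fun x => |u x| * L)
      (fun n => hu.1.mul (by fun_prop)) (hu.abs.mul_const _)
      (fun n => Eventually.of_forall fun x => ?_) (Eventually.of_forall fun x => ?_)
    · rw [Real.norm_eq_abs, abs_mul]
      refine mul_le_mul_of_nonneg_left ?_ (abs_nonneg _)
      have hp : (0 : ℝ) < 1 / (n + 1) := by positivity
      rw [abs_mul, abs_of_pos (inv_pos.2 hp), inv_mul_le_iff₀ hp]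
      have := hL.dist_le_mul (x + 1 / (n + 1)) x
      simp only [Real.dist_eq, add_sub_cancel_left, abs_of_pos hp] at this
      linarith
    · have hd : HasDerivAt ψ (deriv ψ x) x :=
        (hψ.differentiable (by simp)).differentiableAt.hasDerivAt
      exact ((hasDerivAt_iff_tendsto_slope_zero.1 hd).comp hseq).const_mul _
  refine le_of_tendsto hlim (Eventually.of_forall fun n => ?_)
  set ε : ℝ := 1 / (n + 1)
  have hε : 0 < ε := by positivity
  have hbdd : ∀ {v : ℝ → ℝ} (c : ℝ), Integrable v → Integrable fun x => v x * ψ (x + c) := by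
    intro v c hv
    refine hv.mul_bdd (c := 1) (by fun_prop) (Eventually.of_forall fun x => hb _)
  have hbdd0 : ∀ {v : ℝ → ℝ}, Integrable v → Integrable fun x => v x * ψ x := fun hv => by
    simpa using hbdd 0 hv
  have e1 : ∫ x, u x * ψ x = ∫ x, u (x + ε) * ψ (x + ε) :=
    (integral_add_right_eq_self (fun x => u x * ψ x) ε).symm
  have e2 : ∫ x, u x * (ε⁻¹ * (ψ (x + ε) - ψ x))
      = ε⁻¹ * ∫ x, (u x - u (x + ε)) * ψ (x + ε) := by
    simp_rw [mul_left_comm _ ε⁻¹]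
    rw [integral_const_mul]
    simp_rw [mul_sub, sub_mul]
    rw [integral_sub (hbdd ε hu) (hbdd0 hu), e1,
      integral_sub (hbdd ε hu) (hbdd ε (hu.comp_add_right ε))]
  rw [e2, inv_mul_le_iff₀ hε, mul_comm]
  refine le_trans ?_ (h ε hε)
  refine integral_mono (hbdd ε (hu.sub (hu.comp_add_right ε))) ((hu.comp_add_right ε).sub hu).abs
    fun x => ?_
  refine (le_abs_self _).trans ?_
  simp only []
  rw [abs_mul, abs_sub_comm]
  exact mul_le_of_le_one_right (abs_nonneg _) (hb _)

/-- The mass on (a, b] is the difference of the tail integrals from a and from b, that is, of u and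
its translate by b - a over (a, ∞). This avoids a pointwise bound of u by its variation. -/
lemma setIntegral_le_of_totalVariation {u : ℝ → ℝ} (hu : IsBV u) {a b : ℝ} (hab : a ≤ b) :
    ∫ x in Ioc a b, u x ≤ (b - a) * (totalVariation u).toReal := by
  have hi := hu.1
  have e1 : ∫ x in Ioi a, u (x + (b - a)) = ∫ x in Ioi b, u x := by
    have := (measurePreserving_add_right volume (b - a)).setIntegral_preimage_emb
      (measurableEmbedding_addRight (b - a)) u (Ioi b)
    simpa using this
  have e2 : ∫ x in Ioc a b, u x = ∫ x in Ioi a, (u x - u (x + (b - a))) := by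
    rw [integral_sub hi.integrableOn (hi.comp_add_right _).integrableOn, e1,
      ← Ioc_union_Ioi_eq_Ioi hab, setIntegral_union (Ioc_disjoint_Ioi le_rfl) measurableSet_Ioi
        hi.integrableOn hi.integrableOn]
    ring
  rw [e2]
  calc ∫ x in Ioi a, (u x - u (x + (b - a)))
      ≤ ∫ x in Ioi a, |u (x + (b - a)) - u x| :=
        integral_mono (hi.sub (hi.comp_add_right _)).integrableOn
          ((hi.comp_add_right _).sub hi).abs.integrableOn
          fun x => (le_abs_self _).trans_eq (abs_sub_comm _ _)
    _ ≤ ∫ x, |u (x + (b - a)) - u x| :=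
        setIntegral_le_integral ((hi.comp_add_right _).sub hi).abs
          (Eventually.of_forall fun x => abs_nonneg _)
    _ ≤ _ := by
        have := integral_abs_translate_sub_le hu (b - a)
        rwa [abs_of_nonneg (sub_nonneg.2 hab)] at this

/-! ### Kruzhkov solutions of scalar conservation laws on the line -/

/-- The Kruzhkov entropy flux of the scalar flux `g`. -/
def kruzhkovFlux (g : ℝ → ℝ) (r κ : ℝ) : ℝ := Real.sign (r - κ) * (g r - g κ)

lemma kruzhkovFlux_comm (g : ℝ → ℝ) (r κ : ℝ) : kruzhkovFlux g r κ = kruzhkovFlux g κ r := by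
  rw [kruzhkovFlux, kruzhkovFlux, ← neg_sub κ r, Real.sign_neg]; ring

lemma abs_kruzhkovFlux_le {g : ℝ → ℝ} {L : NNReal} (hg : LipschitzWith L g) (r κ : ℝ) :
    |kruzhkovFlux g r κ| ≤ L * |r - κ| := by
  rw [kruzhkovFlux, abs_mul]
  have h := hg.dist_le_mul r κ
  rw [Real.dist_eq, Real.dist_eq] at h
  exact (mul_le_of_le_one_left (abs_nonneg _) (abs_real_sign_le_one _)).trans h

lemma measurable_kruzhkovFlux {g : ℝ → ℝ} (hg : Measurable g) :
    Measurable (Function.uncurry (kruzhkovFlux g)) := by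
  unfold kruzhkovFlux Function.uncurry
  have := measurable_real_sign
  fun_prop

/-- Kruzhkov entropy solutions of `u_t + g(u)_x = 0` on `(0, ∞) × ℝ` with values in `[0, M]`. The
function `W` is a pointwise representative of the continuous curve `w` in `L¹(ℝ)`. -/
structure IsKruzhkovSolution (M : ℝ) (g : ℝ → ℝ) (W : ℝ × ℝ → ℝ)
    (w : ℝ → Lp ℝ 1 (volume : Measure ℝ)) : Prop where
  measurable : Measurable W
  mem_Icc : ∀ p, W p ∈ Icc 0 M
  continuous : Continuous w
  ae_eq : ∀ᵐ t, (fun x => W (t, x)) =ᵐ[volume] w t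
  entropy : ∀ κ ∈ Icc 0 M, ∀ φ : ℝ × ℝ → ℝ, IsTestFunction φ →
    0 ≤ ∫ p, (|W p - κ| * fderiv ℝ φ p (1, 0)
      + kruzhkovFlux g (W p) κ * fderiv ℝ φ p (0, 1))

/-- Spatial translation on `L¹(ℝ)`: `translateL1 z f = f(· + z)`. -/
def translateL1 (z : ℝ) (f : Lp ℝ 1 (volume : Measure ℝ)) : Lp ℝ 1 (volume : Measure ℝ) :=
  DomAddAct.mk z +ᵥ f

lemma translateL1_ae_eq (z : ℝ) (f : Lp ℝ 1 (volume : Measure ℝ)) :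
    translateL1 z f =ᵐ[volume] fun x => f (x + z) := by
  have := DomAddAct.vadd_Lp_ae_eq (DomAddAct.mk z) f
  simpa [translateL1, add_comm] using this

lemma continuous_translateL1 :
    Continuous fun p : ℝ × Lp ℝ 1 (volume : Measure ℝ) => translateL1 p.1 p.2 := by
  have hmk : Continuous fun z : ℝ => DomAddAct.mk z := continuous_induced_rng.2 continuous_id
  have : Fact ((1 : ENNReal) ≠ ⊤) := ⟨ENNReal.one_ne_top⟩
  exact (hmk.comp continuous_fst).vadd continuous_snd

lemma translateL1_zero (f : Lp ℝ 1 (volume : Measure ℝ)) : translateL1 0 f = f := by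
  refine Lp.ext ((translateL1_ae_eq 0 f).trans ?_)
  simp

lemma norm_sub_eq_integral (f g : Lp ℝ 1 (volume : Measure ℝ)) {u v : ℝ → ℝ}
    (hu : u =ᵐ[volume] f) (hv : v =ᵐ[volume] g) : ‖f - g‖ = ∫ x, |u x - v x| := by
  rw [L1.norm_eq_integral_norm]
  refine integral_congr_ae ?_
  filter_upwards [hu, hv, Lp.coeFn_sub f g] with x h1 h2 h3
  rw [h3, Pi.sub_apply, h1, h2, Real.norm_eq_abs]

/-! ### Doubling of variables -/

namespace IsKruzhkovSolution

variable {M : ℝ} {g : ℝ → ℝ} {W V : ℝ × ℝ → ℝ} {w v : ℝ → Lp ℝ 1 (volume : Measure ℝ)}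

lemma integrable_indicator_strip (hW : IsKruzhkovSolution M g W w) (R : ℝ) :
    Integrable ((Icc (-R) R ×ˢ (univ : Set ℝ)).indicator W) := by
  rw [integrable_indicator_iff (measurableSet_Icc.prod MeasurableSet.univ), IntegrableOn,
    Measure.volume_eq_prod, ← Measure.prod_restrict, Measure.restrict_univ,
    integrable_prod_iff hW.measurable.aestronglyMeasurable]
  have hae := ae_restrict_of_ae (s := Icc (-R) R) hW.ae_eq
  constructor
  · filter_upwards [hae] with t ht
    exact (L1.integrable_coeFn (w t)).congr ht.symm
  · refine Integrable.congr (f := fun t => ‖w t‖)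
      (hW.continuous.norm.continuousOn.integrableOn_compact isCompact_Icc) ?_
    filter_upwards [hae] with t ht
    rw [L1.norm_eq_integral_norm]
    exact integral_congr_ae (by filter_upwards [ht] with x hx; rw [hx])

/-- Where θ and k do not vanish, both times lie in a bounded interval; there W and V are integrable
in space-time, so the integrand is dominated by two convolution integrands. -/
lemma integrable_doubling (hW : IsKruzhkovSolution M g W w) (hV : IsKruzhkovSolution M g V v)
    {E : (ℝ × ℝ) × (ℝ × ℝ) → ℝ} (hE : Measurable E) {C : ℝ}
    (hEb : ∀ p q, |E (p, q)| ≤ C * |W p - V q|)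
    {θ : ℝ → ℝ} (hθ : Continuous θ) (hθc : HasCompactSupport θ)
    {k : ℝ × ℝ → ℝ} (hk : Continuous k) (hkc : HasCompactSupport k) :
    Integrable (fun z : (ℝ × ℝ) × (ℝ × ℝ) => E z * (θ z.1.1 * k (z.1 - z.2))) := by
  obtain ⟨R, hR, hθR⟩ := exists_radius_of_hasCompactSupport hθc
  obtain ⟨r, hr, hkr⟩ := hkc.isCompact.isBounded.subset_closedBall_lt 0 0
  obtain ⟨Cθ, hCθ⟩ := hθc.exists_bound_of_continuous hθ
  have hkint : Integrable k := hk.integrable_of_hasCompactSupport hkc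
  set S : Set (ℝ × ℝ) := Icc (-(R + r)) (R + r) ×ˢ univ
  have hC : ∀ p q, 0 ≤ C * |W p - V q| := fun p q => (abs_nonneg _).trans (hEb p q)
  have i1 : Integrable fun z : (ℝ × ℝ) × (ℝ × ℝ) => S.indicator W z.1 * k (z.1 - z.2) := by
    have := ((hW.integrable_indicator_strip (R + r)).convolution_integrand (μ := volume)
      (ContinuousLinearMap.mul ℝ ℝ) hkint.comp_neg).swap
    simp only [Function.comp_def, ContinuousLinearMap.mul_apply', Prod.fst_swap, Prod.snd_swap,
      neg_sub] at this
    exact this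
  have i2 : Integrable fun z : (ℝ × ℝ) × (ℝ × ℝ) => S.indicator V z.2 * k (z.1 - z.2) := by
    have := (hV.integrable_indicator_strip (R + r)).convolution_integrand (μ := volume)
      (ContinuousLinearMap.mul ℝ ℝ) hkint
    exact this
  refine Integrable.mono' ((i1.norm.add i2.norm).const_mul (|C| * Cθ))
    (hE.mul (by fun_prop)).aestronglyMeasurable (Eventually.of_forall fun z => ?_)
  obtain ⟨p, q⟩ := z
  have hnn : 0 ≤ |C| * Cθ * (‖S.indicator W p * k (p - q)‖ + ‖S.indicator V q * k (p - q)‖) :=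
    mul_nonneg (mul_nonneg (abs_nonneg _) ((norm_nonneg _).trans (hCθ 0))) (by positivity)
  by_cases hk0 : k (p - q) = 0
  · simp [hk0]
  by_cases hθ0 : θ p.1 = 0
  · simpa [hθ0] using hnn
  have hpR : |p.1| ≤ R := by by_contra h; exact hθ0 (hθR _ (not_le.1 h))
  have hqr : |p.1 - q.1| ≤ r := by
    have := hkr (subset_tsupport _ hk0)
    rw [mem_closedBall_zero_iff] at this
    exact (norm_fst_le (p - q)).trans this
  have hpS : p ∈ S := ⟨abs_le.1 (by linarith), trivial⟩
  have hqS : q ∈ S := by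
    refine ⟨abs_le.1 ?_, trivial⟩
    have := abs_sub_abs_le_abs_sub q.1 p.1
    rw [abs_sub_comm] at this
    linarith
  simp only [Pi.add_apply, indicator_of_mem hpS, indicator_of_mem hqS, norm_mul, ← add_mul]
  have hb : |W p - V q| ≤ ‖W p‖ + ‖V q‖ := norm_sub_le (W p) (V q)
  calc ‖E (p, q)‖ * (‖θ p.1‖ * ‖k (p - q)‖)
      ≤ (|C| * (‖W p‖ + ‖V q‖)) * (Cθ * ‖k (p - q)‖) := by
        refine mul_le_mul ((hEb p q).trans ?_)
          (mul_le_mul_of_nonneg_right (hCθ _) (norm_nonneg _)) (by positivity) (by positivity)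
        exact mul_le_mul (le_abs_self C) hb (abs_nonneg _) (abs_nonneg _)
    _ = _ := by ring

/-- The doubling-of-variables inequality; the flux terms cancel. -/
lemma doubling (hW : IsKruzhkovSolution M g W w) (hV : IsKruzhkovSolution M g V v)
    {L : NNReal} (hg : LipschitzWith L g)
    {θ : ℝ → ℝ} (hθ : ContDiff ℝ ∞ θ) (hθ0 : ∀ t, 0 ≤ θ t) {a b : ℝ}
    (hθs : ∀ t, t ∉ Icc a b → θ t = 0)
    {k : ℝ × ℝ → ℝ} (hk : ContDiff ℝ ∞ k) (hk0 : ∀ p, 0 ≤ k p) (hkc : HasCompactSupport k)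
    {r : ℝ} (hkr : ∀ p, k p ≠ 0 → ‖p‖ ≤ r) (hra : r < a) :
    0 ≤ ∫ z : (ℝ × ℝ) × (ℝ × ℝ), |W z.1 - V z.2| * (deriv θ z.1.1 * k (z.1 - z.2)) := by
  by_cases hr0 : 0 ≤ r
  swap
  · have : ∀ p, k p = 0 := fun p => by
      by_contra h
      exact hr0 ((norm_nonneg _).trans (hkr p h))
    simp [this]
  have hθcs : HasCompactSupport θ := HasCompactSupport.intro isCompact_Icc (fun t ht => hθs t ht)
  have hθd : ∀ t, HasDerivAt θ (deriv θ t) t := fun t =>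
    (hθ.differentiable (by simp)).differentiableAt.hasDerivAt
  have hkd : ∀ p, HasFDerivAt k (fderiv ℝ k p) p := fun p =>
    (hk.differentiable (by simp)).differentiableAt.hasFDerivAt
  -- The time cutoff θ depends on p only. The derivatives of k in p and q are then opposite, and
  -- only the θ' term survives the sum of the two entropy inequalities.
  have htest1 : ∀ q : ℝ × ℝ, IsTestFunction fun p => θ p.1 * k (p - q) := by
    intro q
    refine ⟨by fun_prop, ?_, ?_, fun p => mul_nonneg (hθ0 _) (hk0 _)⟩
    · exact HasCompactSupport.mul_left (hkc.comp_homeomorph (Homeomorph.subRight q))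
    · have hcl : IsClosed {p : ℝ × ℝ | a ≤ p.1} := isClosed_le continuous_const continuous_fst
      refine (closure_minimal (fun p hp => ?_) hcl).trans
        (fun p hp => ⟨(hr0.trans_lt hra).trans_le hp, trivial⟩)
      by_contra h
      exact hp (by simp [hθs p.1 fun h' => h h'.1])
  -- The condition r < a is what keeps the time of q positive.
  have htest2 : ∀ p : ℝ × ℝ, IsTestFunction fun q => θ p.1 * k (p - q) := by
    intro p
    refine ⟨by fun_prop, ?_, ?_, fun p => mul_nonneg (hθ0 _) (hk0 _)⟩
    · exact HasCompactSupport.mul_left (hkc.comp_homeomorph (Homeomorph.subLeft p))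
    · have hcl : IsClosed {q : ℝ × ℝ | a - r ≤ q.1} := isClosed_le continuous_const continuous_fst
      refine (closure_minimal (fun q hq => ?_) hcl).trans
        (fun q (hq : a - r ≤ q.1) => ⟨(sub_pos.2 hra).trans_le hq, trivial⟩)
      have h1 : θ p.1 ≠ 0 := fun h => hq (by simp [h])
      have h2 : k (p - q) ≠ 0 := fun h => hq (by simp [h])
      have h3 : a ≤ p.1 := by by_contra h; exact h1 (hθs _ fun h' => h h'.1)
      have h4 := (abs_le.1 ((norm_fst_le (p - q)).trans (hkr _ h2))).2
      simp only [Prod.fst_sub] at h4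
      change a - r ≤ q.1
      linarith
  have hfd1 : ∀ q p d, fderiv ℝ (fun p : ℝ × ℝ => θ p.1 * k (p - q)) p d
      = deriv θ p.1 * d.1 * k (p - q) + θ p.1 * fderiv ℝ k (p - q) d := by
    intro q p d
    have h1 : HasFDerivAt (fun p : ℝ × ℝ => θ p.1) _ p :=
      (hθd p.1).comp_hasFDerivAt p (hasFDerivAt_fst (𝕜 := ℝ) (E := ℝ) (F := ℝ))
    have h2 : HasFDerivAt (fun p : ℝ × ℝ => k (p - q)) _ p :=
      (hkd (p - q)).comp p ((hasFDerivAt_id p).sub_const q)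
    rw [(h1.fun_mul h2).fderiv]
    simp
    ring
  have hfd2 : ∀ p q d, fderiv ℝ (fun q : ℝ × ℝ => θ p.1 * k (p - q)) q d
      = -(θ p.1 * fderiv ℝ k (p - q) d) := by
    intro p q d
    have h2 : HasFDerivAt (fun q : ℝ × ℝ => k (p - q)) _ q :=
      (hkd (p - q)).comp q ((hasFDerivAt_id q).const_sub p)
    rw [(h2.const_mul (θ p.1)).fderiv]
    simp
  have hkd_cont : ∀ d, Continuous fun p => fderiv ℝ k p d := fun d =>
    (hk.continuous_fderiv (by simp)).clm_apply continuous_const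
  have hkd_cs : ∀ d, HasCompactSupport fun p => fderiv ℝ k p d := fun d =>
    hkc.fderiv_apply (𝕜 := ℝ) d
  have hθd_cont : Continuous (deriv θ) := hθ.continuous_deriv (by simp)
  have hθd_cs : HasCompactSupport (deriv θ) := hθcs.deriv
  have hWm := hW.measurable
  have hVm := hV.measurable
  have mη : Measurable fun z : (ℝ × ℝ) × (ℝ × ℝ) => |W z.1 - V z.2| := by fun_prop
  have mQ : Measurable fun z : (ℝ × ℝ) × (ℝ × ℝ) => kruzhkovFlux g (W z.1) (V z.2) :=
    (measurable_kruzhkovFlux hg.continuous.measurable).comp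
      ((hWm.comp measurable_fst).prodMk (hVm.comp measurable_snd))
  have bη : ∀ p q, |(|W p - V q|)| ≤ 1 * |W p - V q| := fun p q => by simp
  have I0 := integrable_doubling hW hV mη bη hθd_cont hθd_cs hk.continuous hkc
  have I1 := integrable_doubling hW hV mη bη hθ.continuous hθcs (hkd_cont (1, 0)) (hkd_cs (1, 0))
  have I2 := integrable_doubling hW hV mQ (fun p q => abs_kruzhkovFlux_le hg (W p) (V q))
    hθ.continuous hθcs (hkd_cont (0, 1)) (hkd_cs (0, 1))
  have IA : Integrable fun z : (ℝ × ℝ) × (ℝ × ℝ) =>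
      |W z.1 - V z.2| * (deriv θ z.1.1 * k (z.1 - z.2))
      + |W z.1 - V z.2| * (θ z.1.1 * fderiv ℝ k (z.1 - z.2) (1, 0))
      + kruzhkovFlux g (W z.1) (V z.2) * (θ z.1.1 * fderiv ℝ k (z.1 - z.2) (0, 1)) :=
    (I0.add I1).add I2
  have IB : Integrable fun z : (ℝ × ℝ) × (ℝ × ℝ) =>
      -(|W z.1 - V z.2| * (θ z.1.1 * fderiv ℝ k (z.1 - z.2) (1, 0)))
      - kruzhkovFlux g (W z.1) (V z.2) * (θ z.1.1 * fderiv ℝ k (z.1 - z.2) (0, 1)) :=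
    I1.neg.sub I2
  have hA : 0 ≤ ∫ z : (ℝ × ℝ) × (ℝ × ℝ), (|W z.1 - V z.2| * (deriv θ z.1.1 * k (z.1 - z.2))
      + |W z.1 - V z.2| * (θ z.1.1 * fderiv ℝ k (z.1 - z.2) (1, 0))
      + kruzhkovFlux g (W z.1) (V z.2) * (θ z.1.1 * fderiv ℝ k (z.1 - z.2) (0, 1))) := by
    rw [Measure.volume_eq_prod, integral_prod_symm _ IA]
    refine integral_nonneg fun q => ?_
    refine (hW.entropy (V q) (hV.mem_Icc q) _ (htest1 q)).trans_eq ?_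
    refine integral_congr_ae (Eventually.of_forall fun p => ?_)
    simp only [hfd1]
    ring
  have hB : 0 ≤ ∫ z : (ℝ × ℝ) × (ℝ × ℝ),
      (-(|W z.1 - V z.2| * (θ z.1.1 * fderiv ℝ k (z.1 - z.2) (1, 0)))
      - kruzhkovFlux g (W z.1) (V z.2) * (θ z.1.1 * fderiv ℝ k (z.1 - z.2) (0, 1))) := by
    rw [Measure.volume_eq_prod, integral_prod _ IB]
    refine integral_nonneg fun p => ?_
    refine (hV.entropy (W p) (hW.mem_Icc p) _ (htest2 p)).trans_eq ?_
    refine integral_congr_ae (Eventually.of_forall fun q => ?_)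
    simp only [hfd2]
    rw [abs_sub_comm, kruzhkovFlux_comm]
    ring
  have hsum := add_nonneg hA hB
  rw [← integral_add IA IB] at hsum
  refine hsum.trans_eq (integral_congr_ae (Eventually.of_forall fun z => ?_))
  simp only []
  ring

end IsKruzhkovSolution

/-! ### Passage to the diagonal and L¹ contraction -/

/-- A continuous function that integrates nonnegatively against all small bumps at `0` is
nonnegative at `0`. -/
lemma nonneg_of_forall_bump {G : Type*} [NormedAddCommGroup G] [NormedSpace ℝ G]
    [FiniteDimensional ℝ G] [MeasurableSpace G] [BorelSpace G] {μ : Measure G}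
    [μ.IsAddHaarMeasure] {Φ : G → ℝ} (hΦ : Continuous Φ) {r₀ : ℝ} (hr₀ : 0 < r₀)
    (h : ∀ k : ContDiffBump (0 : G), k.rOut < r₀ → 0 ≤ ∫ x, k x * Φ x ∂μ) : 0 ≤ Φ 0 := by
  by_contra! hneg
  have hev : ∀ᶠ x in 𝓝 (0 : G), Φ x < Φ 0 / 2 :=
    hΦ.continuousAt.eventually_lt_const (by linarith)
  obtain ⟨δ, hδ, hball⟩ := Metric.eventually_nhds_iff_ball.1 hev
  set ε := min δ r₀ / 2 with hεdef
  have hε : 0 < ε := half_pos (lt_min hδ hr₀)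
  have hεlt : ε < min δ r₀ := half_lt_self (lt_min hδ hr₀)
  let k : ContDiffBump (0 : G) := ⟨ε / 2, ε, half_pos hε, half_lt_self hε⟩
  have h0 := h k (hεlt.trans_le (min_le_right _ _))
  have hkpos : 0 < ∫ x, k x ∂μ := k.integral_pos
  have hkint : Integrable (fun x => k x) μ := k.integrable
  have hle : ∫ x, k x * Φ x ∂μ ≤ ∫ x, k x * (Φ 0 / 2) ∂μ := by
    refine integral_mono ?_ (hkint.mul_const _) fun x => ?_
    · exact (k.continuous.mul hΦ).integrable_of_hasCompactSupport k.hasCompactSupport.mul_right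
    · by_cases hx : x ∈ Metric.ball (0 : G) ε
      · exact mul_le_mul_of_nonneg_left
          (hball x (Metric.ball_subset_ball (hεlt.le.trans (min_le_left _ _)) hx)).le k.nonneg
      · have : k x = 0 := k.zero_of_le_dist (not_lt.1 fun h' => hx h')
        simp [this]
  rw [integral_mul_const] at hle
  nlinarith

namespace IsKruzhkovSolution

variable {M : ℝ} {g : ℝ → ℝ} {W V : ℝ × ℝ → ℝ} {w v : ℝ → Lp ℝ 1 (volume : Measure ℝ)}

lemma integral_abs_sub_translate (hW : IsKruzhkovSolution M g W w)
    (hV : IsKruzhkovSolution M g V v) (r : ℝ × ℝ) :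
    ∀ᵐ t, ∫ x, |W (t, x) - V ((t, x) - r)| = ‖w t - translateL1 (-r.2) (v (t - r.1))‖ := by
  have h2 : ∀ᵐ t, (fun x => V (t - r.1, x)) =ᵐ[volume] v (t - r.1) :=
    (measurePreserving_sub_right volume r.1).quasiMeasurePreserving.ae hV.ae_eq
  filter_upwards [hW.ae_eq, h2] with t h1 h2
  have h3 : (fun x => V (t - r.1, x - r.2)) =ᵐ[volume] fun x => v (t - r.1) (x - r.2) :=
    (measurePreserving_sub_right volume r.2).quasiMeasurePreserving.ae h2
  refine (norm_sub_eq_integral _ _ h1 (h3.trans ?_)).symm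
  filter_upwards [translateL1_ae_eq (-r.2) (v (t - r.1))] with x hx
  rw [hx, ← sub_eq_add_neg]

/-- The shear (p, q) ↦ (p, p - q) isolates k(r). What remains for fixed r is continuous in r,
because w, v and translation are continuous in L¹; so k can later concentrate at r = 0. -/
lemma integral_doubling_eq (hW : IsKruzhkovSolution M g W w) (hV : IsKruzhkovSolution M g V v)
    {η : ℝ → ℝ} (hη : Continuous η) {a b : ℝ} (hηs : ∀ t, t ∉ Icc a b → η t = 0)
    {k : ℝ × ℝ → ℝ} (hk : Continuous k) (hkc : HasCompactSupport k) :
    ∫ z : (ℝ × ℝ) × (ℝ × ℝ), |W z.1 - V z.2| * (η z.1.1 * k (z.1 - z.2))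
      = ∫ r : ℝ × ℝ, k r * ∫ t in Icc a b, η t * ‖w t - translateL1 (-r.2) (v (t - r.1))‖ := by
  have hηcs : HasCompactSupport η := HasCompactSupport.intro isCompact_Icc (fun t ht => hηs t ht)
  have hWm := hW.measurable
  have hVm := hV.measurable
  set F : (ℝ × ℝ) × (ℝ × ℝ) → ℝ := fun z => |W z.1 - V z.2| * (η z.1.1 * k (z.1 - z.2)) with hF
  have hFi : Integrable F := integrable_doubling hW hV (E := fun z => |W z.1 - V z.2|)
    (by fun_prop) (C := 1) (fun p q => by simp) hη hηcs hk hkc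
  have hS : MeasurePreserving (fun z : (ℝ × ℝ) × (ℝ × ℝ) => (z.1, z.1 - z.2))
      (volume.prod volume) (volume.prod volume) :=
    (MeasurePreserving.id volume).skew_product (g := fun p r => p - r) (by fun_prop)
      (Eventually.of_forall fun p => (Measure.measurePreserving_sub_left volume p).map_eq)
  have hFS : Integrable (fun z : (ℝ × ℝ) × (ℝ × ℝ) => F (z.1, z.1 - z.2))
      (volume.prod volume) := hS.integrable_comp_of_integrable hFi
  have e1 : ∫ z, F z = ∫ z : (ℝ × ℝ) × (ℝ × ℝ), F (z.1, z.1 - z.2) ∂(volume.prod volume) := by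
    have h := integral_map hS.aemeasurable (f := F) (by rw [hS.map_eq]; exact hFi.1)
    rw [hS.map_eq] at h
    exact h
  rw [e1, integral_prod_symm _ hFS]
  refine integral_congr_ae ?_
  filter_upwards [hFS.prod_left_ae] with r hr
  -- Fubini gives integrability of the slice only after multiplication by k r, which must be nonzero
  -- to be divided out.
  by_cases hk0 : k r = 0
  · simp [hF, hk0]
  simp only [hF, sub_sub_cancel] at hr ⊢
  have e2 : ∀ p : ℝ × ℝ, |W p - V (p - r)| * (η p.1 * k r)
      = k r * (|W p - V (p - r)| * η p.1) := fun p => by ring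
  simp_rw [e2] at hr ⊢
  have hr' : Integrable fun p : ℝ × ℝ => |W p - V (p - r)| * η p.1 := by
    have := hr.const_mul (k r)⁻¹
    simpa [← mul_assoc, inv_mul_cancel₀ hk0] using this
  rw [integral_const_mul]
  congr 1
  rw [Measure.volume_eq_prod, integral_prod _ hr',
    setIntegral_eq_integral_of_forall_compl_eq_zero (fun t ht => by rw [hηs t ht, zero_mul])]
  refine integral_congr_ae ?_
  filter_upwards [integral_abs_sub_translate hW hV r] with t ht
  rw [integral_mul_const, ht, mul_comm]

/-- Letting k concentrate at the origin turns doubling into the weak form of d/dt ‖w - v‖ ≤ 0. -/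
lemma integral_deriv_mul_norm_sub_nonneg (hW : IsKruzhkovSolution M g W w)
    (hV : IsKruzhkovSolution M g V v) {L : NNReal} (hg : LipschitzWith L g)
    {θ : ℝ → ℝ} (hθ : ContDiff ℝ ∞ θ) (hθ0 : ∀ t, 0 ≤ θ t) {a b : ℝ} (ha : 0 < a)
    (hθs : tsupport θ ⊆ Icc a b) :
    0 ≤ ∫ t in Icc a b, deriv θ t * ‖w t - v t‖ := by
  have hd : Continuous (deriv θ) := hθ.continuous_deriv (by simp)
  have hds : ∀ t, t ∉ Icc a b → deriv θ t = 0 := fun t ht => by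
    by_contra h
    exact ht (hθs (support_deriv_subset h))
  set Φ : ℝ × ℝ → ℝ := fun r =>
    ∫ t in Icc a b, deriv θ t * ‖w t - translateL1 (-r.2) (v (t - r.1))‖ with hΦ
  have hcont : Continuous Φ := by
    refine continuous_parametric_integral_of_continuous (s := Icc a b) ?_ isCompact_Icc
    have h1 : Continuous fun z : (ℝ × ℝ) × ℝ =>
        translateL1 (-z.1.2) (v (z.2 - z.1.1)) :=
      continuous_translateL1.comp ((continuous_fst.snd.neg).prodMk
        (hV.continuous.comp (continuous_snd.sub continuous_fst.fst)))
    exact (hd.comp continuous_snd).mul ((hW.continuous.comp continuous_snd).sub h1).norm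
  have h0 : 0 ≤ Φ 0 := by
    refine nonneg_of_forall_bump (μ := volume) hcont ha fun k hk => ?_
    rw [← integral_doubling_eq hW hV hd hds k.continuous k.hasCompactSupport]
    refine doubling hW hV hg hθ hθ0 (b := b) (fun t ht => ?_) k.contDiff (fun p => k.nonneg)
      k.hasCompactSupport (r := k.rOut) (fun p hp => ?_) hk
    · by_contra h
      exact ht (hθs (subset_tsupport _ h))
    · by_contra! h
      exact hp (k.zero_of_le_dist (by rw [dist_zero_right]; exact h.le))
  simpa [hΦ, translateL1_zero] using h0

lemma norm_sub_le_of_pos (hW : IsKruzhkovSolution M g W w)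
    (hV : IsKruzhkovSolution M g V v) {L : NNReal} (hg : LipschitzWith L g)
    {s t : ℝ} (hs : 0 < s) (hst : s ≤ t) : ‖w t - v t‖ ≤ ‖w s - v s‖ := by
  set D : ℝ → ℝ := fun t => ‖w t - v t‖ with hD
  have hDc : Continuous D := (hW.continuous.sub hV.continuous).norm
  have key : 0 ≤ (fun y => D (y + s) - D (y + t)) 0 := by
    -- The window integral of a bump is a smoothed indicator of [s, t] whose derivative is the bump
    -- at s minus the bump at t. Radius below s/2 keeps its support in positive times.
    refine nonneg_of_forall_bump (μ := volume) (Φ := fun y => D (y + s) - D (y + t))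
      (by fun_prop) (half_pos hs) fun k hk => ?_
    have hkr : ∀ y, k.rOut < |y| → k y = 0 := fun y hy =>
      k.zero_of_le_dist (by rw [Real.dist_eq, sub_zero]; exact hy.le)
    have hkc : Continuous k := k.continuous
    have hsupp := tsupport_windowIntegral_subset (a := s) (b := t) hkr
    rw [min_eq_left hst, max_eq_right hst] at hsupp
    have hnn : ∀ x, 0 ≤ windowIntegral k s t x := fun x =>
      intervalIntegral.integral_nonneg (by linarith) fun y _ => k.nonneg
    have h := integral_deriv_mul_norm_sub_nonneg hW hV hg
      (contDiff_windowIntegral k.contDiff s t) hnn (a := s - k.rOut) (b := t + k.rOut)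
      (by linarith) hsupp
    rw [setIntegral_eq_integral_of_forall_compl_eq_zero (fun x hx => by
      have : deriv (windowIntegral k s t) x = 0 := by
        by_contra h'
        exact hx (hsupp (support_deriv_subset h'))
      rw [this, zero_mul]), deriv_windowIntegral hkc] at h
    have hint : ∀ c, Integrable fun x => k (x - c) * D x := fun c =>
      Continuous.integrable_of_hasCompactSupport (by fun_prop)
        (HasCompactSupport.mul_right (k.hasCompactSupport.comp_homeomorph (Homeomorph.subRight c)))
    have hshift : ∀ c, ∫ x, k (x - c) * D x = ∫ y, k y * D (y + c) := fun c => by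
      rw [← integral_add_right_eq_self (fun x => k (x - c) * D x) c]
      simp
    have hint' : ∀ c, Integrable fun y => k y * D (y + c) := fun c =>
      Continuous.integrable_of_hasCompactSupport (by fun_prop)
        (HasCompactSupport.mul_right k.hasCompactSupport)
    simp_rw [sub_mul] at h
    rw [integral_sub (hint s) (hint t), hshift, hshift, ← integral_sub (hint' s) (hint' t)] at h
    simpa [mul_sub] using h
  simpa using key

/-- Kruzhkov's `L¹` contraction. -/
theorem norm_sub_le (hW : IsKruzhkovSolution M g W w)
    (hV : IsKruzhkovSolution M g V v) {L : NNReal} (hg : LipschitzWith L g)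
    {t : ℝ} (ht : 0 ≤ t) : ‖w t - v t‖ ≤ ‖w 0 - v 0‖ := by
  rcases ht.eq_or_lt with rfl | ht
  · exact le_rfl
  have hDc : Continuous fun s => ‖w s - v s‖ := (hW.continuous.sub hV.continuous).norm
  refine ge_of_tendsto (hDc.continuousAt.tendsto.mono_left (nhdsWithin_le_nhds (s := Ioi 0))) ?_
  filter_upwards [Ioo_mem_nhdsGT ht] with s hs
  exact norm_sub_le_of_pos hW hV hg hs.1 hs.2.le

/-- Spatial translates of Kruzhkov solutions are Kruzhkov solutions. -/
lemma translate (hW : IsKruzhkovSolution M g W w) (h : ℝ) :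
    IsKruzhkovSolution M g (fun p => W (p.1, p.2 + h)) (fun t => translateL1 h (w t)) where
  measurable := hW.measurable.comp (by fun_prop)
  mem_Icc p := hW.mem_Icc _
  continuous := continuous_translateL1.comp (continuous_const.prodMk hW.continuous)
  ae_eq := by
    filter_upwards [hW.ae_eq] with t ht
    have h1 : (fun x => W (t, x + h)) =ᵐ[volume] fun x => w t (x + h) :=
      (measurePreserving_add_right volume h).quasiMeasurePreserving.ae ht
    exact h1.trans (translateL1_ae_eq h (w t)).symm
  entropy κ hκ φ hφ := by
    set c : ℝ × ℝ := (0, h)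
    have htest : IsTestFunction fun p => φ (p - c) := by
      refine ⟨hφ.smooth.comp (by fun_prop),
        hφ.compactSupport.comp_homeomorph (Homeomorph.subRight c), ?_, fun p => hφ.nonneg _⟩
      intro p hp
      have : p - c ∈ tsupport φ :=
        tsupport_comp_subset_preimage φ (f := fun p => p - c) (by fun_prop) hp
      have := (hφ.tsupport_subset this).1
      exact ⟨by simpa [c] using this, trivial⟩
    have h1 := hW.entropy κ hκ _ htest
    have hfd : ∀ p, fderiv ℝ (fun p => φ (p - c)) p = fderiv ℝ φ (p - c) := fun p =>
      fderiv_comp_sub (f := φ) (x := p) c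
    simp_rw [hfd] at h1
    rw [← integral_add_right_eq_self _ c] at h1
    simp_rw [add_sub_cancel_right] at h1
    have hc : ∀ p : ℝ × ℝ, p + c = (p.1, p.2 + h) := fun p => by ext <;> simp [c]
    simpa only [hc] using h1

end IsKruzhkovSolution

/-! ### Cutoffs near a Lipschitz curve -/

/-- Mollification preserves the Lipschitz constant, so cutoffs built on ζ have gradients of order
1/ε with a constant independent of the approximation. -/
lemma exists_contDiff_approx_of_lipschitzWith {ξ : ℝ → ℝ} {K : NNReal} (hξ : LipschitzWith K ξ)
    {ε : ℝ} (hε : 0 < ε) :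
    ∃ ζ : ℝ → ℝ, ContDiff ℝ ∞ ζ ∧ LipschitzWith K ζ ∧ ∀ t, |ζ t - ξ t| ≤ ε := by
  set δ : ℝ := ε / (K + 1) with hδdef
  have hK : (0 : ℝ) < K + 1 := by positivity
  have hδ : 0 < δ := div_pos hε hK
  let φ : ContDiffBump (0 : ℝ) := ⟨δ / 2, δ, half_pos hδ, half_lt_self hδ⟩
  set ζ : ℝ → ℝ := convolution (φ.normed volume) ξ (ContinuousLinearMap.lsmul ℝ ℝ) volume
  have hex : ConvolutionExists (φ.normed volume) ξ (ContinuousLinearMap.lsmul ℝ ℝ) volume :=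
    φ.hasCompactSupport_normed.convolutionExists_left _ φ.continuous_normed
      hξ.continuous.locallyIntegrable
  refine ⟨ζ, ?_, ?_, fun t => ?_⟩
  · exact HasCompactSupport.contDiff_convolution_left _ φ.hasCompactSupport_normed
      φ.contDiff_normed hξ.continuous.locallyIntegrable
  · refine LipschitzWith.of_dist_le_mul fun s t => ?_
    have h1 : ζ s - ζ t = ∫ y, φ.normed volume y * (ξ (s - y) - ξ (t - y)) := by
      simp_rw [mul_sub]
      exact (integral_sub (hex s) (hex t)).symm
    have h2 : ∫ y, φ.normed volume y * (K * dist s t) = K * dist s t := by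
      rw [integral_mul_const, φ.integral_normed, one_mul]
    rw [Real.dist_eq, h1, ← h2, ← Real.norm_eq_abs]
    refine norm_integral_le_of_norm_le (φ.integrable_normed.mul_const _)
      (Eventually.of_forall fun y => ?_)
    rw [norm_mul, Real.norm_eq_abs, abs_of_nonneg (φ.nonneg_normed y)]
    refine mul_le_mul_of_nonneg_left ?_ (φ.nonneg_normed y)
    have := hξ.dist_le_mul (s - y) (t - y)
    rwa [dist_sub_right, Real.dist_eq (ξ _)] at this
  · rw [← Real.dist_eq]
    refine φ.dist_normed_convolution_le hξ.continuous.aestronglyMeasurable fun x hx => ?_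
    refine (hξ.dist_le_mul x t).trans ?_
    have hx' : dist x t < δ := hx
    calc (K : ℝ) * dist x t ≤ (K + 1) * δ := by gcongr; linarith
      _ = ε := by rw [hδdef]; field_simp

lemma exists_lipschitzWith_smoothTransition : ∃ C, LipschitzWith C Real.smoothTransition := by
  have hsm : ContDiff ℝ ∞ Real.smoothTransition := Real.smoothTransition.contDiff
  have hcs : HasCompactSupport (deriv Real.smoothTransition) := by
    refine HasCompactSupport.intro (K := Icc 0 1) isCompact_Icc fun x hx => ?_
    rw [mem_Icc, not_and_or, not_le, not_le] at hx
    rcases hx with hx | hx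
    · have : Real.smoothTransition =ᶠ[𝓝 x] fun _ => 0 := by
        filter_upwards [Iio_mem_nhds hx] with y hy
        exact Real.smoothTransition.zero_of_nonpos (le_of_lt hy)
      rw [this.deriv_eq, deriv_const]
    · have : Real.smoothTransition =ᶠ[𝓝 x] fun _ => 1 := by
        filter_upwards [Ioi_mem_nhds hx] with y hy
        exact Real.smoothTransition.one_of_one_le (le_of_lt hy)
      rw [this.deriv_eq, deriv_const]
  obtain ⟨C, hC⟩ := hcs.exists_bound_of_continuous (hsm.continuous_deriv (by simp))
  refine ⟨C.toNNReal, lipschitzWith_of_nnnorm_deriv_le (hsm.differentiable (by simp)) fun x => ?_⟩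
  exact NNReal.le_toNNReal_of_coe_le (hC x)

/-- A zero of a nonnegative function is a minimum. Gradient terms therefore vanish wherever the test
function does, boundary points of its support included. -/
lemma fderiv_eq_zero_of_nonneg_of_eq_zero {E : Type*} [NormedAddCommGroup E] [NormedSpace ℝ E]
    {φ : E → ℝ} (hφ : ∀ p, 0 ≤ φ p) {p : E} (hp : φ p = 0) : fderiv ℝ φ p = 0 :=
  IsLocalMin.fderiv_eq_zero (Eventually.of_forall fun q => hp.trans_le (hφ q))

lemma integral_fderiv_apply_eq_zero {φ : ℝ × ℝ → ℝ} (hφ : ContDiff ℝ ∞ φ)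
    (hc : HasCompactSupport φ) (d : ℝ × ℝ) : ∫ p, fderiv ℝ φ p d = 0 := by
  have hd : Integrable fun p => fderiv ℝ φ p d :=
    ((hφ.continuous_fderiv (by simp)).clm_apply continuous_const).integrable_of_hasCompactSupport
      (hc.fderiv_apply (𝕜 := ℝ) d)
  have := integral_mul_fderiv_eq_neg_fderiv_mul_of_integrable (μ := (volume : Measure (ℝ × ℝ)))
    (f := fun _ => (1 : ℝ)) (g := φ) (v := d) (by simp) (by simpa using hd)
    (by simpa using hφ.continuous.integrable_of_hasCompactSupport hc)
    (fun _ _ => by fun_prop) (fun _ _ => (hφ.differentiable (by simp)).differentiableAt)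
  simpa using this

/-- The jump of the sign is harmless: below κ the two signs agree, and from κ on the triangle
inequality passes through κ, where the flux is zero. -/
lemma abs_kruzhkovFlux_sub_le {g : ℝ → ℝ} {L : NNReal} (hg : LipschitzWith L g) {r κ : ℝ}
    (hr : 0 ≤ r) (hκ : 0 ≤ κ) : |kruzhkovFlux g r κ - kruzhkovFlux g 0 κ| ≤ L * r := by
  have hL : (0 : ℝ) ≤ L := L.2
  rcases hκ.eq_or_lt with rfl | hκ
  · simpa [kruzhkovFlux, abs_of_nonneg hr] using abs_kruzhkovFlux_le hg r 0
  have h0 : kruzhkovFlux g 0 κ = g κ - g 0 := by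
    rw [kruzhkovFlux, Real.sign_of_neg (by linarith)]; ring
  have hd : ∀ x y, |g x - g y| ≤ L * |x - y| := fun x y => by
    simpa [Real.dist_eq] using hg.dist_le_mul x y
  rcases lt_or_ge r κ with h | h
  · rw [h0, kruzhkovFlux, Real.sign_of_neg (by linarith)]
    have := hd 0 r
    rw [zero_sub, abs_neg, abs_of_nonneg hr] at this
    convert this using 2; ring
  · have h1 : |kruzhkovFlux g r κ| ≤ L * (r - κ) := by
      simpa [abs_of_nonneg (sub_nonneg.2 h)] using abs_kruzhkovFlux_le hg r κ
    have h2 : |kruzhkovFlux g 0 κ| ≤ L * κ := by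
      simpa [abs_of_pos hκ] using abs_kruzhkovFlux_le hg 0 κ
    refine (abs_sub _ _).trans ?_
    linarith

/-! ### One side of a turning curve along which the density has zero trace -/

/-- The open side `σ (x - ξ(t)) > 0` of the curve `x = ξ(t)`. -/
def curveSide (σ : ℝ) (ξ : ℝ → ℝ) : Set (ℝ × ℝ) := {p | 0 < σ * (p.2 - ξ p.1)}

/-- The strip of width `ε` and duration `T` adjacent to the curve `x = ξ(t)`. -/
def curveStrip (σ : ℝ) (ξ : ℝ → ℝ) (T ε : ℝ) : Set (ℝ × ℝ) :=
  {p | p.1 ∈ Ioo 0 T ∧ σ * (p.2 - ξ p.1) ∈ Ioo 0 ε}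

lemma measurableSet_curveSide {σ : ℝ} {ξ : ℝ → ℝ} (hξ : Continuous ξ) :
    MeasurableSet (curveSide σ ξ) :=
  (isOpen_lt continuous_const (by fun_prop)).measurableSet

lemma measurableSet_curveStrip {σ : ℝ} {ξ : ℝ → ℝ} (hξ : Continuous ξ) (T ε : ℝ) :
    MeasurableSet (curveStrip σ ξ T ε) :=
  (measurable_fst measurableSet_Ioo).inter
    ((by fun_prop : Measurable fun p : ℝ × ℝ => σ * (p.2 - ξ p.1)) measurableSet_Ioo)

lemma integrable_kruzhkov_integrand {M : ℝ} {g : ℝ → ℝ} {L : NNReal} (hg : LipschitzWith L g)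
    {P : ℝ × ℝ → ℝ} (hP : Measurable P) (hPM : ∀ p, P p ∈ Icc 0 M) (κ : ℝ)
    {φ : ℝ × ℝ → ℝ} (hφ : ContDiff ℝ ∞ φ) (hc : HasCompactSupport φ) :
    Integrable fun p => |P p - κ| * fderiv ℝ φ p (1, 0)
      + kruzhkovFlux g (P p) κ * fderiv ℝ φ p (0, 1) := by
  have hd : ∀ d, Integrable fun p => fderiv ℝ φ p d := fun d =>
    ((hφ.continuous_fderiv (by simp)).clm_apply continuous_const).integrable_of_hasCompactSupport
      (hc.fderiv_apply (𝕜 := ℝ) d)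
  have hb : ∀ p, |P p - κ| ≤ M + |κ| := fun p => by
    refine (abs_sub _ _).trans ?_
    rw [abs_of_nonneg (hPM p).1]
    linarith [(hPM p).2]
  have hQ : Measurable fun p => kruzhkovFlux g (P p) κ :=
    (measurable_kruzhkovFlux hg.continuous.measurable).comp (hP.prodMk measurable_const)
  refine Integrable.add ((hd _).bdd_mul (c := M + |κ|) (by fun_prop) ?_)
    ((hd _).bdd_mul (c := L * (M + |κ|)) hQ.aestronglyMeasurable ?_)
  · exact Eventually.of_forall fun p => by simpa using hb p
  · exact Eventually.of_forall fun p => (abs_kruzhkovFlux_le hg _ _).trans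
      (mul_le_mul_of_nonneg_left (hb p) L.2)

/-- If a density satisfies the entropy inequality on one side of a Lipschitz curve and has zero
trace there, its extension by zero satisfies the entropy inequality on the whole plane. -/
lemma entropy_indicator_curveSide {M : ℝ} {g : ℝ → ℝ} {L : NNReal} (hg : LipschitzWith L g)
    {P : ℝ × ℝ → ℝ} (hP : Measurable P) (hPM : ∀ p, P p ∈ Icc 0 M)
    {ξ : ℝ → ℝ} {K : NNReal} (hξ : LipschitzWith K ξ) {σ : ℝ} (hσ : |σ| = 1)
    (hent : ∀ κ ∈ Icc 0 M, ∀ φ : ℝ × ℝ → ℝ, IsTestFunction φ →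
      (∀ p, p ∉ curveSide σ ξ → φ p = 0) →
      0 ≤ ∫ p, (|P p - κ| * fderiv ℝ φ p (1, 0) + kruzhkovFlux g (P p) κ * fderiv ℝ φ p (0, 1)))
    (htrace : ∀ T, 0 < T → ∀ δ, 0 < δ → ∃ ε₀, 0 < ε₀ ∧ ∀ ε, 0 < ε → ε < ε₀ →
      ∫ p in curveStrip σ ξ T ε, P p ≤ ε * δ) (hM : 0 ≤ M)
    {κ : ℝ} (hκ : κ ∈ Icc 0 M) {φ : ℝ × ℝ → ℝ} (hφ : IsTestFunction φ) :
    0 ≤ ∫ p, (|(curveSide σ ξ).indicator P p - κ| * fderiv ℝ φ p (1, 0)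
      + kruzhkovFlux g ((curveSide σ ξ).indicator P p) κ * fderiv ℝ φ p (0, 1)) := by
  set W := (curveSide σ ξ).indicator P with hW
  have hWm : Measurable W := hP.indicator (measurableSet_curveSide hξ.continuous)
  have hWM : ∀ p, W p ∈ Icc 0 M := fun p => by
    by_cases hp : p ∈ curveSide σ ξ
    · simpa [hW, hp] using hPM p
    · simpa [hW, hp] using hM
  obtain ⟨Cs, hCs⟩ := exists_lipschitzWith_smoothTransition
  obtain ⟨B, hB⟩ := hφ.compactSupport.exists_bound_of_continuous hφ.smooth.continuous
  obtain ⟨A, hA⟩ := (hφ.compactSupport.fderiv ℝ).exists_bound_of_continuous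
    (hφ.smooth.continuous_fderiv (by simp))
  obtain ⟨T, hT, hφT⟩ : ∃ T, 0 < T ∧ ∀ p, φ p ≠ 0 → p.1 ∈ Ioo 0 T := by
    obtain ⟨r, hr, h⟩ := hφ.compactSupport.isCompact.isBounded.subset_closedBall_lt 0 0
    refine ⟨r + 1, by linarith, fun p hp => ⟨(hφ.tsupport_subset (subset_tsupport _ hp)).1, ?_⟩⟩
    have h1 := h (subset_tsupport _ hp)
    rw [mem_closedBall_zero_iff] at h1
    have := (le_abs_self _).trans ((norm_fst_le p).trans h1)
    linarith
  have hA0 : 0 ≤ A := (norm_nonneg _).trans (hA 0)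
  have hB0 : 0 ≤ B := (norm_nonneg _).trans (hB 0)
  -- For ε ≤ 1, C/ε bounds the gradient of the near-curve part φ₂ of the test function. The error is
  -- then at most (1 + L)(C/ε) times a strip mass 3εδ, which dictates δ; the + 1 there only avoids a
  -- zero denominator.
  set C : ℝ := A + B * (Cs * (1 + K)) with hC
  have hC0 : 0 ≤ C := by positivity
  refine le_of_forall_pos_le_add fun η hη => ?_
  set δ : ℝ := η / (3 * ((1 + L) * C) + 1) with hδ
  have hδ0 : 0 < δ := by positivity
  obtain ⟨ε₀, hε₀, hstrip⟩ := htrace T hT δ hδ0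
  set ε : ℝ := min 1 (ε₀ / 3) / 2 with hεdef
  have hmin : 0 < min 1 (ε₀ / 3) := lt_min one_pos (by positivity)
  have hε : 0 < ε := half_pos hmin
  have hε1 : ε ≤ 1 := (half_le_self hmin.le).trans (min_le_left _ _)
  have hε3 : 3 * ε < ε₀ := by
    have := (half_lt_self hmin).trans_le (min_le_right _ _)
    linarith
  obtain ⟨ζ, hζs, hζL, hζ⟩ := exists_contDiff_approx_of_lipschitzWith hξ hε
  -- Since ζ is within ε of ξ, the shift by 1 makes X vanish off the open side, and X = 1 beyond
  -- distance 3ε from the curve.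
  set X : ℝ × ℝ → ℝ := fun p => Real.smoothTransition (σ * (p.2 - ζ p.1) / ε - 1) with hX
  have hXs : ContDiff ℝ ∞ X :=
    (Real.smoothTransition.contDiff (n := (⊤ : ℕ∞))).comp (by fun_prop)
  have hX0 : ∀ p, 0 ≤ X p := fun p => Real.smoothTransition.nonneg _
  have hX1 : ∀ p, X p ≤ 1 := fun p => Real.smoothTransition.le_one _
  have hdiff : ∀ p : ℝ × ℝ, |σ * (p.2 - ζ p.1) - σ * (p.2 - ξ p.1)| ≤ ε := fun p => by
    rw [← mul_sub, abs_mul, hσ, one_mul, sub_sub_sub_cancel_left, abs_sub_comm]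
    exact hζ p.1
  have hXout : ∀ p, p ∉ curveSide σ ξ → X p = 0 := fun p hp => by
    refine Real.smoothTransition.zero_of_nonpos ?_
    have h1 : σ * (p.2 - ξ p.1) ≤ 0 := not_lt.1 hp
    have h2 := (abs_le.1 (hdiff p)).2
    rw [sub_nonpos, div_le_one hε]
    linarith
  have hXin : ∀ p : ℝ × ℝ, 3 * ε ≤ σ * (p.2 - ξ p.1) → X p = 1 := fun p hp => by
    refine Real.smoothTransition.one_of_one_le ?_
    have h2 := (abs_le.1 (hdiff p)).1
    have : 2 ≤ σ * (p.2 - ζ p.1) / ε := by rw [le_div_iff₀ hε]; linarith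
    linarith
  have hXlip : ∀ p, ‖fderiv ℝ X p‖ ≤ Cs * (1 + K) / ε := fun p => by
    refine norm_fderiv_le_of_lip' ℝ (by positivity) (Eventually.of_forall fun q => ?_)
    have h1 := hCs.dist_le_mul (σ * (q.2 - ζ q.1) / ε - 1) (σ * (p.2 - ζ p.1) / ε - 1)
    rw [Real.dist_eq, Real.dist_eq] at h1
    refine h1.trans ?_
    have h2 : |σ * (q.2 - ζ q.1) / ε - 1 - (σ * (p.2 - ζ p.1) / ε - 1)|
        = |(q.2 - p.2) - (ζ q.1 - ζ p.1)| / ε := by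
      rw [sub_sub_sub_cancel_right, ← sub_div, abs_div, abs_of_pos hε, ← mul_sub, abs_mul, hσ,
        one_mul]
      congr 2; ring
    have h3 : |ζ q.1 - ζ p.1| ≤ K * |q.1 - p.1| := by
      simpa [Real.dist_eq] using hζL.dist_le_mul q.1 p.1
    have h4 : |q.1 - p.1| ≤ ‖q - p‖ := norm_fst_le (q - p)
    have h5 : |q.2 - p.2| ≤ ‖q - p‖ := norm_snd_le (q - p)
    have h6 : |(q.2 - p.2) - (ζ q.1 - ζ p.1)| ≤ (1 + K) * ‖q - p‖ := by
      refine (abs_sub _ _).trans ?_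
      have : (K : ℝ) * |q.1 - p.1| ≤ K * ‖q - p‖ := mul_le_mul_of_nonneg_left h4 K.2
      linarith
    rw [h2]
    calc (Cs : ℝ) * (|(q.2 - p.2) - (ζ q.1 - ζ p.1)| / ε)
        ≤ Cs * ((1 + K) * ‖q - p‖ / ε) := by gcongr
      _ = _ := by ring
  set φ₁ : ℝ × ℝ → ℝ := fun p => φ p * X p with hφ₁
  set φ₂ : ℝ × ℝ → ℝ := fun p => φ p * (1 - X p) with hφ₂
  have hφs := hφ.smooth
  have hs₁ : ContDiff ℝ ∞ φ₁ := hφs.mul hXs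
  have hs₂ : ContDiff ℝ ∞ φ₂ := hφs.mul (contDiff_const.sub hXs)
  have hc₁ : HasCompactSupport φ₁ := hφ.compactSupport.mul_right
  have hc₂ : HasCompactSupport φ₂ := hφ.compactSupport.mul_right
  have hn₁ : ∀ p, 0 ≤ φ₁ p := fun p => mul_nonneg (hφ.nonneg p) (hX0 p)
  have hn₂ : ∀ p, 0 ≤ φ₂ p := fun p => mul_nonneg (hφ.nonneg p) (sub_nonneg.2 (hX1 p))
  have ht₁ : IsTestFunction φ₁ :=
    ⟨hs₁, hc₁, (tsupport_mul_subset_left).trans hφ.tsupport_subset, hn₁⟩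
  have hsplit : ∀ p d, fderiv ℝ φ p d = fderiv ℝ φ₁ p d + fderiv ℝ φ₂ p d := fun p d => by
    have h1 := (hs₁.differentiable (by simp)).differentiableAt (x := p)
    have h2 := (hs₂.differentiable (by simp)).differentiableAt (x := p)
    rw [← add_apply, ← fderiv_add h1 h2]
    congr 2
    ext q
    simp only [hφ₁, hφ₂, Pi.add_apply]
    ring
  have hd₂ : ∀ p, ‖fderiv ℝ φ₂ p‖ ≤ C / ε := fun p => by
    have h1 := (hφs.differentiable (by simp)).differentiableAt (x := p)
    have h2 := (hXs.differentiable (by simp)).differentiableAt (x := p)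
    have h3 : HasFDerivAt φ₂ _ p := h1.hasFDerivAt.fun_mul (h2.hasFDerivAt.const_sub 1)
    rw [h3.fderiv]
    calc ‖φ p • -fderiv ℝ X p + (1 - X p) • fderiv ℝ φ p‖
        ≤ ‖φ p‖ * ‖fderiv ℝ X p‖ + ‖1 - X p‖ * ‖fderiv ℝ φ p‖ := by
          refine (norm_add_le _ _).trans ?_
          rw [norm_smul, norm_smul, norm_neg]
      _ ≤ B * (Cs * (1 + K) / ε) + 1 * A := by
          have : ‖1 - X p‖ ≤ 1 := by
            rw [Real.norm_eq_abs, abs_of_nonneg (sub_nonneg.2 (hX1 p))]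
            linarith [hX0 p]
          exact add_le_add (mul_le_mul (hB p) (hXlip p) (norm_nonneg _) hB0)
            (mul_le_mul this (hA p) (norm_nonneg _) zero_le_one)
      _ ≤ C / ε := by
          have : A ≤ A / ε := by rw [le_div_iff₀ hε]; exact mul_le_of_le_one_right hA0 hε1
          have e : B * (Cs * (1 + K) / ε) = B * (Cs * (1 + K)) / ε := by ring
          rw [hC, add_div, one_mul, e]
          linarith
  have I₁ := integrable_kruzhkov_integrand hg hWm hWM κ hs₁ hc₁
  have I₂ := integrable_kruzhkov_integrand hg hWm hWM κ hs₂ hc₂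
  have I₀ := integrable_kruzhkov_integrand hg (P := fun _ => (0 : ℝ)) measurable_const
    (fun _ => ⟨le_rfl, hM⟩) κ hs₂ hc₂
  have hsum : ∫ p, (|W p - κ| * fderiv ℝ φ p (1, 0) + kruzhkovFlux g (W p) κ * fderiv ℝ φ p (0, 1))
      = (∫ p, (|W p - κ| * fderiv ℝ φ₁ p (1, 0) + kruzhkovFlux g (W p) κ * fderiv ℝ φ₁ p (0, 1)))
      + ∫ p, (|W p - κ| * fderiv ℝ φ₂ p (1, 0)
          + kruzhkovFlux g (W p) κ * fderiv ℝ φ₂ p (0, 1)) := by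
    rw [← integral_add I₁ I₂]
    refine integral_congr_ae (Eventually.of_forall fun p => ?_)
    simp only [hsplit]
    ring
  have hfirst : 0 ≤ ∫ p, (|W p - κ| * fderiv ℝ φ₁ p (1, 0)
      + kruzhkovFlux g (W p) κ * fderiv ℝ φ₁ p (0, 1)) := by
    refine (hent κ hκ φ₁ ht₁ fun p hp => by simp [hφ₁, hXout p hp]).trans_eq ?_
    refine integral_congr_ae (Eventually.of_forall fun p => ?_)
    by_cases hp : p ∈ curveSide σ ξ
    · simp only [hW, indicator_of_mem hp]
    · have : fderiv ℝ φ₁ p = 0 :=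
        fderiv_eq_zero_of_nonneg_of_eq_zero hn₁ (by simp [hφ₁, hXout p hp])
      simp [this]
  -- The zero density gives no contribution, so it can be subtracted from the φ₂ term; the
  -- difference is then controlled by P and lives on the strip.
  have hzero : ∫ p, (|(0 : ℝ) - κ| * fderiv ℝ φ₂ p (1, 0)
      + kruzhkovFlux g 0 κ * fderiv ℝ φ₂ p (0, 1)) = 0 := by
    have hd : ∀ d, Integrable fun p => fderiv ℝ φ₂ p d := fun d =>
      ((hs₂.continuous_fderiv (by simp)).clm_apply
        continuous_const).integrable_of_hasCompactSupport (hc₂.fderiv_apply (𝕜 := ℝ) d)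
    rw [integral_add ((hd _).const_mul _) ((hd _).const_mul _), integral_const_mul,
      integral_const_mul, integral_fderiv_apply_eq_zero hs₂ hc₂,
      integral_fderiv_apply_eq_zero hs₂ hc₂]
    simp
  set S := curveStrip σ ξ T (3 * ε)
  have hSm : MeasurableSet S := measurableSet_curveStrip hξ.continuous _ _
  have hSint : IntegrableOn P S := by
    refine Measure.integrableOn_of_bounded (M := M) ?_ hP.aestronglyMeasurable
      (Eventually.of_forall fun p => ?_)
    · obtain ⟨R, hR⟩ := isCompact_Icc.exists_bound_of_continuousOn (s := Icc 0 T)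
        hξ.continuous.continuousOn
      have hsub : S ⊆ Icc 0 T ×ˢ Icc (-(R + 3 * ε)) (R + 3 * ε) := by
        intro p hp
        have h1 : p.1 ∈ Icc 0 T := Ioo_subset_Icc_self hp.1
        have h2 : |p.2 - ξ p.1| ≤ 3 * ε := by
          rw [← one_mul |p.2 - ξ p.1|, ← hσ, ← abs_mul, abs_of_pos hp.2.1]
          exact hp.2.2.le
        refine ⟨h1, abs_le.1 ?_⟩
        have h3 := hR p.1 h1
        rw [Real.norm_eq_abs] at h3
        calc |p.2| = |(p.2 - ξ p.1) + ξ p.1| := by ring_nf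
          _ ≤ _ := (abs_add_le _ _).trans (by linarith)
      exact ((isCompact_Icc.prod isCompact_Icc).measure_lt_top.trans_le' (measure_mono hsub)).ne
    · rw [Real.norm_eq_abs, abs_of_nonneg (hPM p).1]
      exact (hPM p).2
  have hsecond : |∫ p, (|W p - κ| * fderiv ℝ φ₂ p (1, 0)
      + kruzhkovFlux g (W p) κ * fderiv ℝ φ₂ p (0, 1))| ≤ η := by
    have e0 := integral_sub I₂ I₀
    rw [hzero, sub_zero] at e0
    rw [← e0]
    calc _ ≤ ∫ p, (1 + L) * (C / ε) * S.indicator P p := by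
          rw [← Real.norm_eq_abs]
          refine norm_integral_le_of_norm_le
            (((integrable_indicator_iff hSm).2 hSint).const_mul _)
            (Eventually.of_forall fun p => ?_)
          have hind : 0 ≤ S.indicator P p := indicator_nonneg (fun q _ => (hPM q).1) p
          by_cases hp : p ∈ curveSide σ ξ
          swap
          · simp only [hW, indicator_of_notMem hp, sub_self, norm_zero]
            positivity
          by_cases hp2 : φ₂ p = 0
          · simp only [fderiv_eq_zero_of_nonneg_of_eq_zero hn₂ hp2]
            simp only [zero_apply, mul_zero, add_zero, sub_self, norm_zero]
            positivity
          have hpS : p ∈ S := by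
            refine ⟨hφT p fun h => hp2 (by simp [hφ₂, h]), hp, ?_⟩
            by_contra! h
            exact hp2 (by simp [hφ₂, hXin p h])
          have hWP : W p = P p := indicator_of_mem hp P
          have hP0 := (hPM p).1
          rw [indicator_of_mem hpS, hWP]
          have e : |P p - κ| * fderiv ℝ φ₂ p (1, 0) + kruzhkovFlux g (P p) κ * fderiv ℝ φ₂ p (0, 1)
              - (|0 - κ| * fderiv ℝ φ₂ p (1, 0) + kruzhkovFlux g 0 κ * fderiv ℝ φ₂ p (0, 1))
              = (|P p - κ| - |0 - κ|) * fderiv ℝ φ₂ p (1, 0)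
              + (kruzhkovFlux g (P p) κ - kruzhkovFlux g 0 κ) * fderiv ℝ φ₂ p (0, 1) := by ring
          rw [e]
          have hdb : ∀ d : ℝ × ℝ, ‖d‖ = 1 → ‖fderiv ℝ φ₂ p d‖ ≤ C / ε := fun d hd => by
            have := (fderiv ℝ φ₂ p).le_opNorm d
            rw [hd, mul_one] at this
            exact this.trans (hd₂ p)
          have b1 : ‖|P p - κ| - |0 - κ|‖ ≤ P p := by
            have := abs_abs_sub_abs_le_abs_sub (P p - κ) (0 - κ)
            rwa [sub_sub_sub_cancel_right, sub_zero, abs_of_nonneg hP0] at this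
          have b2 : ‖kruzhkovFlux g (P p) κ - kruzhkovFlux g 0 κ‖ ≤ L * P p :=
            abs_kruzhkovFlux_sub_le hg hP0 hκ.1
          refine (norm_add_le _ _).trans ?_
          rw [norm_mul, norm_mul]
          have c1 := mul_le_mul b1 (hdb (1, 0) (by simp [Prod.norm_def])) (norm_nonneg _) hP0
          have c2 := mul_le_mul b2 (hdb (0, 1) (by simp [Prod.norm_def])) (norm_nonneg _)
            (by positivity)
          linarith
      _ = (1 + L) * (C / ε) * ∫ p in S, P p := by
          rw [integral_const_mul, integral_indicator hSm]
      _ ≤ (1 + L) * (C / ε) * (3 * ε * δ) := by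
          gcongr
          exact hstrip _ (by positivity) hε3
      _ = 3 * ((1 + L) * C) * δ := by field_simp
      _ ≤ η := by
          rw [hδ, mul_div_assoc', div_le_iff₀ (by positivity)]
          nlinarith
  rw [hsum]
  linarith [(abs_le.1 hsecond).1]

/-! ### The two sides of a well-separated solution -/

lemma lipschitzWith_mul_of_side {g : ℝ → ℝ} {L : NNReal} (hg : LipschitzWith L g) {σ : ℝ}
    (hσ : σ = 1 ∨ σ = -1) : LipschitzWith L fun r => σ * g r := by
  refine LipschitzWith.of_dist_le_mul fun x y => ?_
  have h := hg.dist_le_mul x y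
  have hσ1 : |σ| = 1 := by rcases hσ with rfl | rfl <;> simp
  rw [Real.dist_eq] at h ⊢
  rwa [← mul_sub, abs_mul, hσ1, one_mul]

/-- These coordinates straighten the curve: the first is the distance h used in the trace condition,
the second is time. -/
lemma measurePreserving_alongCurve {σ : ℝ} (hσ : σ = 1 ∨ σ = -1) {ξ : ℝ → ℝ} (hξ : Continuous ξ) :
    MeasurePreserving (fun z : ℝ × ℝ => (z.2, ξ z.2 + σ * z.1)) (volume.prod volume)
      (volume.prod volume) := by
  have h1 : MeasurePreserving (fun z : ℝ × ℝ => (z.1, ξ z.1 + σ * z.2)) (volume.prod volume)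
      (volume.prod volume) := by
    refine (MeasurePreserving.id volume).skew_product (g := fun t h => ξ t + σ * h) (by fun_prop)
      (Eventually.of_forall fun t => ?_)
    rcases hσ with rfl | rfl
    · simpa using (measurePreserving_add_left volume (ξ t)).map_eq
    · simpa [← sub_eq_add_neg] using (Measure.measurePreserving_sub_left volume (ξ t)).map_eq
  exact h1.comp Measure.measurePreserving_swap

lemma mem_uIcc_of_side {σ a b x : ℝ} (hσ : σ = 1 ∨ σ = -1) (h1 : 0 < σ * (x - a))
    (h2 : ¬ 0 < σ * (x - b)) : x ∈ uIcc a b := by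
  rw [mem_uIcc]
  rcases hσ with rfl | rfl
  · left; constructor <;> linarith
  · right; constructor <;> linarith

/-- The part of the spatial profile `u` on the side `σ (x - a) > 0` of the point `a`. -/
def sidePart (σ a : ℝ) (u : ℝ → ℝ) : ℝ → ℝ := {x | 0 < σ * (x - a)}.indicator u

lemma measurableSet_side (σ a : ℝ) : MeasurableSet {x : ℝ | 0 < σ * (x - a)} :=
  (isOpen_lt continuous_const (by fun_prop)).measurableSet

/-- Moving the cut matters only between a and b, at a cost of at most M per point. This serves both
continuity in time and the translation modulus at the cut. -/
lemma abs_sidePart_sub_le {σ a b : ℝ} (hσ : σ = 1 ∨ σ = -1) {u v : ℝ → ℝ} {M x : ℝ}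
    (hv : |v x| ≤ M) :
    |sidePart σ a u x - sidePart σ b v x| ≤ |u x - v x| + (uIcc a b).indicator (fun _ => M) x := by
  have hM : 0 ≤ M := (abs_nonneg _).trans hv
  have hind : 0 ≤ (uIcc a b).indicator (fun _ => M) x := indicator_nonneg (fun _ _ => hM) x
  simp only [sidePart, indicator, mem_ofPred_eq] at hind ⊢
  by_cases h1 : 0 < σ * (x - a) <;> by_cases h2 : 0 < σ * (x - b)
  · simp only [h1, h2, if_true]; linarith
  · have := mem_uIcc_of_side hσ h1 h2
    simp only [h1, h2, this, if_true, if_false, sub_zero]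
    have := abs_sub_abs_le_abs_sub (u x) (v x)
    linarith
  · have := mem_uIcc_of_side hσ h2 h1
    rw [uIcc_comm] at this
    simp only [h1, h2, this, if_true, if_false, zero_sub, abs_neg]
    linarith [abs_nonneg (u x - v x)]
  · simp only [h1, h2, if_false, sub_self, abs_zero]
    linarith [abs_nonneg (u x - v x)]

namespace IsEntropySolution

variable {M : ℝ} {f c ρ₀ : ℝ → ℝ} {ρ : ℝ → ℝ → ℝ} {ξ : ℝ → ℝ}

/-- Freezing the density at its initial value for t < 0 gives a curve on all of ℝ; clipping to [0,
M] makes the range condition hold everywhere, as doubling needs when W p and V q serve as κ. -/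
lemma exists_measurable_representative (hsol : IsEntropySolution M f c ρ₀ ρ ξ) (hM : 0 ≤ M) :
    ∃ P : ℝ × ℝ → ℝ, Measurable P ∧ (∀ p, P p ∈ Icc 0 M) ∧
      ∀ᵐ p : ℝ × ℝ, P p = ρ (max p.1 0) p.2 := by
  have hm : AEMeasurable (fun p : ℝ × ℝ => ρ (max p.1 0) p.2) volume := by
    have hu : (univ : Set (ℝ × ℝ)) = (Ici 0 ×ˢ univ) ∪ (Iio 0 ×ˢ univ) := by
      ext p
      simp [le_or_gt]
    rw [← Measure.restrict_univ (μ := volume), hu, aemeasurable_union_iff]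
    constructor
    · refine hsol.aemeasurable.congr ?_
      refine ae_restrict_of_forall_mem (measurableSet_Ici.prod MeasurableSet.univ) fun p hp => ?_
      have : (0 : ℝ) ≤ p.1 := hp.1
      simp [Function.uncurry_def, this]
    · have h0 : AEMeasurable (fun p : ℝ × ℝ => ρ 0 p.2) volume :=
        (hsol.integrable 0 le_rfl).aemeasurable.comp_quasiMeasurePreserving
          Measure.quasiMeasurePreserving_snd
      refine h0.restrict.congr ?_
      refine ae_restrict_of_forall_mem (measurableSet_Iio.prod MeasurableSet.univ) fun p hp => ?_
      have : p.1 < 0 := hp.1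
      simp [this.le]
  set P₀ := hm.mk
  have hP₀ : Measurable P₀ := hm.measurable_mk
  have hae : ∀ᵐ p : ℝ × ℝ, P₀ p = ρ (max p.1 0) p.2 := hm.ae_eq_mk.symm
  have hrange : ∀ᵐ p : ℝ × ℝ, P₀ p ∈ Icc 0 M := by
    rw [Measure.volume_eq_prod, Measure.ae_prod_iff_ae_ae (hP₀ measurableSet_Icc)]
    rw [Measure.volume_eq_prod] at hae
    filter_upwards [Measure.ae_ae_of_ae_prod hae] with t ht
    filter_upwards [ht, hsol.mem_Icc (max t 0) (le_max_right _ _)] with x h1 h2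
    rwa [h1]
  refine ⟨fun p => max 0 (min M (P₀ p)), by fun_prop,
    fun p => ⟨le_max_left _ _, max_le hM (min_le_left _ _)⟩, ?_⟩
  filter_upwards [hae, hrange] with p h1 h2
  rw [min_eq_right h2.2, max_eq_right h2.1, h1]

/-- A test function vanishing off one open side also vanishes on the curve, so the source term drops
out, and sign(x - ξ(t)) is the constant σ where it is positive. -/
lemma entropy_side (hsol : IsEntropySolution M f c ρ₀ ρ ξ) {g : ℝ → ℝ} {L : NNReal}
    (hg : LipschitzWith L g) (hfg : EqOn f g (Icc 0 M)) {P : ℝ × ℝ → ℝ} (hP : Measurable P)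
    (hPM : ∀ p, P p ∈ Icc 0 M) (hPρ : ∀ᵐ p : ℝ × ℝ, P p = ρ (max p.1 0) p.2)
    {χ : ℝ → ℝ} (hχ : EqOn ξ χ (Ici 0)) {σ : ℝ} (hσ : σ = 1 ∨ σ = -1)
    {κ : ℝ} (hκ : κ ∈ Icc 0 M) {φ : ℝ × ℝ → ℝ} (hφ : IsTestFunction φ)
    (hφ0 : ∀ p, p ∉ curveSide σ χ → φ p = 0) :
    0 ≤ ∫ p, (|P p - κ| * fderiv ℝ φ p (1, 0)
      + kruzhkovFlux (fun r => σ * g r) (P p) κ * fderiv ℝ φ p (0, 1)) := by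
  have hσL := lipschitzWith_mul_of_side hg hσ
  have hI := integrable_kruzhkov_integrand hσL hP hPM κ hφ.smooth hφ.compactSupport
  have hpos : ∀ p : ℝ × ℝ, φ p ≠ 0 → 0 < p.1 := fun p hp =>
    (hφ.tsupport_subset (subset_tsupport _ hp)).1
  have hfd0 : ∀ p : ℝ × ℝ, φ p = 0 → fderiv ℝ φ p = 0 := fun p hp =>
    fderiv_eq_zero_of_nonneg_of_eq_zero hφ.nonneg hp
  have hd : ∀ p : ℝ × ℝ, HasFDerivAt φ (fderiv ℝ φ p) p := fun p =>
    (hφ.smooth.differentiable (by simp)).differentiableAt.hasFDerivAt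
  have hdt : ∀ t x, deriv (fun s => φ (s, x)) t = fderiv ℝ φ (t, x) (1, 0) := fun t x =>
    ((hd (t, x)).comp_hasDerivAt t ((hasDerivAt_id t).prodMk (hasDerivAt_const t x))).deriv
  have hdx : ∀ t x, deriv (fun y => φ (t, y)) x = fderiv ℝ φ (t, x) (0, 1) := fun t x =>
    ((hd (t, x)).comp_hasDerivAt x ((hasDerivAt_const x t).prodMk (hasDerivAt_id x))).deriv
  have h := hsol.entropy κ hκ φ hφ
  have hcurve : ∫ t in Ioi 0, f κ * φ (t, ξ t) = 0 := by
    refine setIntegral_eq_zero_of_forall_eq_zero fun t ht => ?_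
    rw [hφ0 (t, ξ t), mul_zero]
    simp [curveSide, hχ (mem_Ici.2 (le_of_lt ht))]
  rw [hcurve, mul_zero, add_zero] at h
  rw [Measure.volume_eq_prod, integral_prod _ hI]
  refine h.trans_eq (Eq.trans ?_
    (setIntegral_eq_integral_of_forall_compl_eq_zero (s := Ioi (0 : ℝ)) ?_))
  · rw [Measure.volume_eq_prod] at hPρ
    refine integral_congr_ae ?_
    filter_upwards [ae_restrict_of_ae (Measure.ae_ae_of_ae_prod hPρ),
      ae_restrict_mem measurableSet_Ioi] with t h1 ht
    refine integral_congr_ae ?_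
    filter_upwards [h1] with x hx
    have ht0 : (0 : ℝ) < t := ht
    simp only [max_eq_left ht0.le] at hx
    simp only [hdt, hdx, ← hx]
    by_cases h0 : φ (t, x) = 0
    · simp [hfd0 _ h0]
    have hs : 0 < σ * (x - χ t) := by
      by_contra hs
      exact h0 (hφ0 _ hs)
    have hsign : Real.sign (x - ξ t) = σ := by
      rw [hχ (mem_Ici.2 ht0.le)]
      rcases hσ with rfl | rfl
      · exact Real.sign_of_pos (by linarith)
      · exact Real.sign_of_neg (by linarith)
    rw [entropyFlux, kruzhkovFlux, hsign, hfg (hPM (t, x)), hfg hκ]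
    ring
  · intro t ht
    refine integral_eq_zero_of_ae (Eventually.of_forall fun x => ?_)
    have : φ (t, x) = 0 := by
      by_contra h0
      exact ht (hpos _ h0)
    simp [hfd0 _ this]

lemma setIntegral_curveStrip_le {P : ℝ × ℝ → ℝ} (hP : Measurable P)
    (hP0 : ∀ p, 0 ≤ P p) (hPρ : ∀ᵐ p : ℝ × ℝ, P p = ρ (max p.1 0) p.2)
    {χ : ℝ → ℝ} (hχc : Continuous χ) (hχ : EqOn ξ χ (Ici 0)) {σ : ℝ} (hσ : σ = 1 ∨ σ = -1)
    (htr : HasStrongTrace ρ ξ σ fun _ => 0) {T : ℝ} (hT : 0 < T) {δ : ℝ} (hδ : 0 < δ) :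
    ∃ ε₀, 0 < ε₀ ∧ ∀ ε, 0 < ε → ε < ε₀ → ∫ p in curveStrip σ χ T ε, P p ≤ ε * δ := by
  have hσσ : ∀ x, σ * (σ * x) = x := fun x => by rcases hσ with rfl | rfl <;> ring
  have hev := (htr T hT).eventually (ge_mem_nhds (ENNReal.ofReal_pos.2 hδ))
  -- The essential limit bounds the slice integral by δ only for almost every small h, which
  -- suffices after integrating over h in (0, ε).
  obtain ⟨s, hs, t, ht, hst⟩ := eventually_inf.1 hev
  obtain ⟨ε₀, hε₀, hsub⟩ := mem_nhdsGT_iff_exists_Ioo_subset.1 hs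
  refine ⟨ε₀, hε₀, fun ε hε hεε₀ => ?_⟩
  set S := curveStrip σ χ T ε
  have hS : MeasurableSet S := measurableSet_curveStrip hχc T ε
  have hmp := measurePreserving_alongCurve hσ hχc
  set F : ℝ × ℝ → ENNReal := S.indicator fun p => ENNReal.ofReal (P p)
  have hF : Measurable F := (by fun_prop : Measurable fun p => ENNReal.ofReal (P p)).indicator hS
  rw [integral_eq_lintegral_of_nonneg_ae (Eventually.of_forall hP0) hP.aestronglyMeasurable]
  refine ENNReal.toReal_le_of_le_ofReal (by positivity) ?_
  have e1 : ∫⁻ p in S, ENNReal.ofReal (P p)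
      = ∫⁻ h : ℝ, ∫⁻ t : ℝ, F (t, χ t + σ * h) := by
    rw [← lintegral_indicator hS, Measure.volume_eq_prod, ← hmp.lintegral_comp hF]
    exact lintegral_prod _ (hF.comp hmp.measurable).aemeasurable
  have hae : ∀ᵐ h : ℝ, ∀ᵐ t : ℝ, P (t, χ t + σ * h) = ρ (max t 0) (χ t + σ * h) :=
    Measure.ae_ae_of_ae_prod (hmp.quasiMeasurePreserving.ae hPρ)
  have hle : ∀ᵐ h : ℝ, ∫⁻ t : ℝ, F (t, χ t + σ * h)
      ≤ (Ioo 0 ε).indicator (fun _ => ENNReal.ofReal δ) h := by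
    filter_upwards [hae, ht] with h h1 h2
    have hmem : ∀ t, (t, χ t + σ * h) ∈ S ↔ t ∈ Ioo 0 T ∧ h ∈ Ioo 0 ε := fun t => by
      simp only [S, curveStrip, mem_ofPred_eq, add_sub_cancel_left, hσσ]
    by_cases hh : h ∈ Ioo 0 ε
    · rw [indicator_of_mem hh]
      refine le_trans ?_ (hst h ⟨hsub ⟨hh.1, hh.2.trans hεε₀⟩, h2⟩)
      rw [← lintegral_indicator measurableSet_Ioo]
      refine lintegral_mono_ae ?_
      filter_upwards [h1] with t h3
      by_cases htT : t ∈ Ioo 0 T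
      · rw [indicator_of_mem htT]
        simp only [F]
        rw [indicator_of_mem ((hmem t).2 ⟨htT, hh⟩), h3, max_eq_left htT.1.le,
          hχ (mem_Ici.2 htT.1.le), sub_zero]
        exact ENNReal.ofReal_le_ofReal (le_abs_self _)
      · simp only [F]
        rw [indicator_of_notMem fun h' => htT ((hmem t).1 h').1]
        exact zero_le
    · have : ∀ t, F (t, χ t + σ * h) = 0 := fun t =>
        indicator_of_notMem (fun h' => hh ((hmem t).1 h').2) _
      simp [this]
  rw [e1]
  refine (lintegral_mono_ae hle).trans ?_
  rw [lintegral_indicator measurableSet_Ioo, setLIntegral_const, Real.volume_Ioo, sub_zero,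
    ← ENNReal.ofReal_mul hδ.le, mul_comm]

/-- Each side of a well-separated solution, extended by zero, is a Kruzhkov solution. -/
theorem exists_isKruzhkovSolution_sidePart (hsol : IsEntropySolution M f c ρ₀ ρ ξ) (hM : 0 ≤ M)
    {g : ℝ → ℝ} {L : NNReal} (hg : LipschitzWith L g) (hfg : EqOn f g (Icc 0 M))
    {σ : ℝ} (hσ : σ = 1 ∨ σ = -1) (htr : HasStrongTrace ρ ξ σ fun _ => 0) :
    ∃ W w, IsKruzhkovSolution M (fun r => σ * g r) W w ∧
      ∀ t, 0 ≤ t → sidePart σ (ξ t) (ρ t) =ᵐ[volume] w t := by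
  obtain ⟨P, hP, hPM, hPρ⟩ := hsol.exists_measurable_representative hM
  obtain ⟨K, hK⟩ := hsol.lipschitz
  -- χ continues ξ to negative times with the same Lipschitz constant.
  obtain ⟨χ, hχL, hχ⟩ := hK.extend_real
  have hσ1 : |σ| = 1 := by rcases hσ with rfl | rfl <;> simp
  have hσL := lipschitzWith_mul_of_side hg hσ
  have hint : ∀ t, Integrable (sidePart σ (χ t) (ρ (max t 0))) := fun t =>
    (hsol.integrable _ (le_max_right _ _)).indicator (measurableSet_side σ _)
  refine ⟨(curveSide σ χ).indicator P, fun t => (hint t).toL1 _,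
    ⟨hP.indicator (measurableSet_curveSide hχL.continuous), fun p => ?_, ?_, ?_, ?_⟩, ?_⟩
  · by_cases hp : p ∈ curveSide σ χ
    · rw [indicator_of_mem hp]; exact hPM p
    · rw [indicator_of_notMem hp]; exact ⟨le_rfl, hM⟩
  · refine continuous_iff_continuousAt.2 fun t => tendsto_iff_edist_tendsto_0.2 ?_
    have hb : ∀ s, edist ((hint s).toL1 _) ((hint t).toL1 _)
        ≤ eLpNorm (ρ (max s 0) - ρ (max t 0)) 1 volume
          + ENNReal.ofReal M * ENNReal.ofReal |χ t - χ s| := by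
      intro s
      rw [Integrable.edist_toL1_toL1, eLpNorm_one_eq_lintegral_enorm, ← Real.volume_interval,
        ← lintegral_indicator_const measurableSet_uIcc,
        ← lintegral_add_right _ (measurable_const.indicator measurableSet_uIcc)]
      refine lintegral_mono_ae ?_
      filter_upwards [hsol.mem_Icc (max t 0) (le_max_right _ _)] with x hx
      have h1 := abs_sidePart_sub_le (a := χ s) (b := χ t) hσ (u := ρ (max s 0))
        (v := ρ (max t 0)) (x := x) (M := M) (by rw [abs_of_nonneg hx.1]; exact hx.2)
      rw [edist_dist, Real.dist_eq]
      refine (ENNReal.ofReal_le_ofReal h1).trans (ENNReal.ofReal_add_le.trans ?_)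
      refine add_le_add (by rw [Pi.sub_apply, Real.enorm_eq_ofReal_abs]) ?_
      by_cases hxu : x ∈ uIcc (χ s) (χ t) <;> simp [hxu]
    have hlim : Tendsto (fun s => eLpNorm (ρ (max s 0) - ρ (max t 0)) 1 volume
          + ENNReal.ofReal M * ENNReal.ofReal |χ t - χ s|) (𝓝 t) (𝓝 0) := by
      have h1 : Tendsto (fun s : ℝ => max s 0) (𝓝 t) (𝓝[Ici 0] (max t 0)) :=
        tendsto_nhdsWithin_iff.2
          ⟨(by fun_prop : Continuous fun s : ℝ => max s 0).continuousAt.tendsto,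
            Eventually.of_forall fun s => mem_Ici.2 (le_max_right _ _)⟩
      have h2 := (hsol.continuous (max t 0) (le_max_right _ _)).comp h1
      have hc := hχL.continuous
      have h3 : Tendsto (fun s => ENNReal.ofReal |χ t - χ s|) (𝓝 t) (𝓝 0) := by
        have : Continuous fun s => ENNReal.ofReal |χ t - χ s| :=
          ENNReal.continuous_ofReal.comp (by fun_prop)
        simpa using this.tendsto t
      have h4 := ENNReal.Tendsto.const_mul (a := ENNReal.ofReal M) h3
        (Or.inr ENNReal.ofReal_ne_top)
      simpa using h2.add h4
    exact tendsto_of_tendsto_of_tendsto_of_le_of_le tendsto_const_nhds hlim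
      (fun _ => zero_le) hb
  · rw [Measure.volume_eq_prod] at hPρ
    filter_upwards [Measure.ae_ae_of_ae_prod hPρ] with t ht
    filter_upwards [ht, (hint t).coeFn_toL1] with x h1 h2
    rw [h2]
    simp only [sidePart, curveSide, indicator, mem_ofPred_eq, h1]
  · intro κ hκ φ hφ
    exact entropy_indicator_curveSide hσL hP hPM hχL hσ1
      (fun κ hκ φ hφ h0 => hsol.entropy_side hg hfg hP hPM hPρ hχ hσ hκ hφ h0)
      (fun T hT δ hδ => setIntegral_curveStrip_le hP (fun p => (hPM p).1) hPρ hχL.continuous hχ hσ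
        htr hT hδ) hM hκ hφ
  · intro t ht
    have := (hint t).coeFn_toL1
    refine EventuallyEq.trans (Eventually.of_forall fun x => ?_) this.symm
    rw [hχ (mem_Ici.2 ht)]
    simp only [max_eq_left ht]

end IsEntropySolution

/-! ### Comparison of sided profiles -/

lemma ae_eq_sidePart_add (a : ℝ) (u : ℝ → ℝ) :
    ∀ᵐ x, u x = sidePart 1 a u x + sidePart (-1) a u x := by
  filter_upwards [compl_mem_ae_iff.2 (measure_singleton (μ := (volume : Measure ℝ)) a)] with x hx
  have hx' : x ≠ a := hx
  simp only [sidePart, indicator, mem_ofPred_eq]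
  rcases lt_or_gt_of_ne hx' with h | h
  · have h1 : ¬ 0 < 1 * (x - a) := by linarith
    have h2 : 0 < -1 * (x - a) := by linarith
    simp only [h1, h2, if_true, if_false, zero_add]
  · have h1 : 0 < 1 * (x - a) := by linarith
    have h2 : ¬ 0 < -1 * (x - a) := by linarith
    simp only [h1, h2, if_true, if_false, add_zero]

lemma integrable_sidePart {u : ℝ → ℝ} (hu : Integrable u) (σ a : ℝ) :
    Integrable (sidePart σ a u) :=
  hu.indicator (measurableSet_side σ a)

lemma sidePart_congr_ae {σ a : ℝ} {u v : ℝ → ℝ} (h : u =ᵐ[volume] v) :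
    sidePart σ a u =ᵐ[volume] sidePart σ a v := by
  filter_upwards [h] with x hx
  simp only [sidePart, indicator, hx]

lemma integral_abs_sub_le_sidePart {u v : ℝ → ℝ} (hu : Integrable u) (hv : Integrable v)
    (a b : ℝ) :
    ∫ x, |u x - v x| ≤ (∫ x, |sidePart 1 a u x - sidePart 1 b v x|)
      + ∫ x, |sidePart (-1) a u x - sidePart (-1) b v x| := by
  have h : ∀ σ, Integrable fun x => |sidePart σ a u x - sidePart σ b v x| := fun σ =>
    ((integrable_sidePart hu σ a).sub (integrable_sidePart hv σ b)).abs
  rw [← integral_add (h 1) (h (-1))]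
  refine integral_mono_ae (hu.sub hv).abs ((h 1).add (h (-1))) ?_
  filter_upwards [ae_eq_sidePart_add a u, ae_eq_sidePart_add b v] with x h1 h2
  rw [h1, h2]
  refine le_trans (le_of_eq ?_) (abs_add_le _ _)
  congr 1
  ring

/-- Strictly between the cuts u and v fall on opposite sides and contribute u + v ≤ |u - v| + 2u.
Writing the excess in u alone means that only u needs bounded variation. -/
lemma abs_sidePart_sub_add_le {a b x : ℝ} {u v : ℝ → ℝ} (hu : 0 ≤ u x) (hv : 0 ≤ v x) :
    |sidePart 1 a u x - sidePart 1 b v x| + |sidePart (-1) a u x - sidePart (-1) b v x|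
      ≤ |u x - v x| + 2 * (uIcc a b).indicator u x := by
  have h1 : u x + v x ≤ |u x - v x| + 2 * u x := by
    linarith [neg_le_abs (u x - v x)]
  have h0 := abs_nonneg (u x - v x)
  have hmem : ∀ {σ : ℝ}, (σ = 1 ∨ σ = -1) → 0 < σ * (x - a) → ¬ 0 < σ * (x - b) →
      x ∈ uIcc a b := fun hσ => mem_uIcc_of_side hσ
  have hmem' : ∀ {σ : ℝ}, (σ = 1 ∨ σ = -1) → 0 < σ * (x - b) → ¬ 0 < σ * (x - a) →
      x ∈ uIcc a b := fun hσ h h' => by rw [uIcc_comm]; exact mem_uIcc_of_side hσ h h'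
  simp only [sidePart, indicator, mem_ofPred_eq]
  by_cases hx : x ∈ uIcc a b
  · have hboth : ∀ c, ¬ (0 < 1 * (x - c) ∧ 0 < -1 * (x - c)) := fun c h => by linarith [h.1, h.2]
    have ha := hboth a
    have hb := hboth b
    simp only [hx, if_true]
    by_cases p1 : 0 < 1 * (x - a) <;> by_cases p2 : 0 < -1 * (x - a) <;>
      by_cases q1 : 0 < 1 * (x - b) <;> by_cases q2 : 0 < -1 * (x - b) <;>
      simp only [p1, p2, q1, q2, if_true, if_false, sub_zero, zero_sub, abs_neg, abs_zero,
        abs_of_nonneg hu, abs_of_nonneg hv, not_true_eq_false, and_self] at ha hb ⊢ <;>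
      linarith
  · have hp : (0 < 1 * (x - a)) ↔ 0 < 1 * (x - b) :=
      ⟨fun h => by by_contra h'; exact hx (hmem (Or.inl rfl) h h'),
        fun h => by by_contra h'; exact hx (hmem' (Or.inl rfl) h h')⟩
    have hq : (0 < -1 * (x - a)) ↔ 0 < -1 * (x - b) :=
      ⟨fun h => by by_contra h'; exact hx (hmem (Or.inr rfl) h h'),
        fun h => by by_contra h'; exact hx (hmem' (Or.inr rfl) h h')⟩
    simp only [hx, if_false, hp, hq]
    by_cases q1 : 0 < 1 * (x - b) <;> by_cases q2 : 0 < -1 * (x - b)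
    · linarith
    all_goals
      simp only [q1, q2, if_true, if_false, sub_self, abs_zero, mul_zero, add_zero, zero_add,
        le_refl, h0]

lemma sum_integral_sidePart_sub_le {u v : ℝ → ℝ} (hu : IsBV u) (hv : Integrable v)
    (hu0 : ∀ x, 0 ≤ u x) (hv0 : ∀ x, 0 ≤ v x) (a b : ℝ) :
    (∫ x, |sidePart 1 a u x - sidePart 1 b v x|)
      + ∫ x, |sidePart (-1) a u x - sidePart (-1) b v x|
      ≤ (∫ x, |u x - v x|) + 2 * (|a - b| * (totalVariation u).toReal) := by
  have h : ∀ σ, Integrable fun x => |sidePart σ a u x - sidePart σ b v x| := fun σ =>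
    ((integrable_sidePart hu.1 σ a).sub (integrable_sidePart hv σ b)).abs
  have hind : Integrable ((uIcc a b).indicator u) := hu.1.indicator measurableSet_uIcc
  have hstrip : ∫ x, (uIcc a b).indicator u x ≤ |a - b| * (totalVariation u).toReal := by
    rw [integral_indicator measurableSet_uIcc, uIcc, integral_Icc_eq_integral_Ioc,
      ← max_sub_min_eq_abs']
    exact setIntegral_le_of_totalVariation hu min_le_max
  rw [← integral_add (h 1) (h (-1))]
  calc _ ≤ ∫ x, (|u x - v x| + 2 * (uIcc a b).indicator u x) :=
        integral_mono ((h 1).add (h (-1))) ((hu.1.sub hv).abs.add (hind.const_mul 2))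
          fun x => abs_sidePart_sub_add_le (hu0 x) (hv0 x)
    _ = (∫ x, |u x - v x|) + 2 * ∫ x, (uIcc a b).indicator u x := by
        rw [← integral_const_mul]
        exact integral_add (hu.1.sub hv).abs (hind.const_mul 2)
    _ ≤ _ := by linarith

/-- Translating a side translates its cut as well; M h pays for the interval between the two cuts.
-/
lemma integral_abs_sidePart_translate_sub_le {σ : ℝ} (hσ : σ = 1 ∨ σ = -1) {u : ℝ → ℝ}
    (hu : IsBV u) {M : ℝ} (huM : ∀ x, u x ∈ Icc 0 M) (a : ℝ) {h : ℝ} (hh : 0 ≤ h) :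
    ∫ x, |sidePart σ a u (x + h) - sidePart σ a u x|
      ≤ h * ((totalVariation u).toReal + M) := by
  have hi := integrable_sidePart hu.1 σ a
  have hM : Integrable ((uIcc (a - h) a).indicator fun _ => M) :=
    (integrable_indicator_iff measurableSet_uIcc).2
      (integrableOn_const (by rw [Real.volume_interval]; exact ENNReal.ofReal_ne_top))
  calc _ ≤ ∫ x, (|u (x + h) - u x| + (uIcc (a - h) a).indicator (fun _ => M) x) := by
        refine integral_mono ((hi.comp_add_right h).sub hi).abs
          (((hu.1.comp_add_right h).sub hu.1).abs.add hM) fun x => ?_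
        have h1 : sidePart σ a u (x + h) = sidePart σ (a - h) (fun y => u (y + h)) x := by
          have : x + h - a = x - (a - h) := by ring
          simp only [sidePart, indicator, mem_ofPred_eq, this]
        simp only [h1]
        exact abs_sidePart_sub_le hσ (u := fun y => u (y + h))
          (by rw [abs_of_nonneg (huM x).1]; exact (huM x).2)
    _ = (∫ x, |u (x + h) - u x|) + h * M := by
        have e : ∫ x, (uIcc (a - h) a).indicator (fun _ => M) x = h * M := by
          rw [integral_indicator measurableSet_uIcc, setIntegral_const,
            Real.volume_real_interval, sub_sub_cancel, abs_of_nonneg hh, smul_eq_mul]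
        rw [← e]
        exact integral_add ((hu.1.comp_add_right h).sub hu.1).abs hM
    _ ≤ _ := by
        have := integral_abs_translate_sub_le hu h
        rw [abs_of_nonneg hh] at this
        linarith

/-! ### Stability and total variation of well-separated solutions -/

section

variable {M : ℝ} {f : ℝ → ℝ} {c₁ c₂ ρ₀₁ ρ₀₂ : ℝ → ℝ} {ρ₁ ρ₂ : ℝ → ℝ → ℝ} {ξ₁ ξ₂ : ℝ → ℝ}

lemma hasStrongTrace_of_isWellSeparated (h : IsWellSeparated ρ₁ ξ₁) {σ : ℝ}
    (hσ : σ = 1 ∨ σ = -1) : HasStrongTrace ρ₁ ξ₁ σ fun _ => 0 := by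
  rcases hσ with rfl | rfl
  · exact h.1
  · exact h.2

/-- On each side, well-separated solutions are `L¹`-contractive. -/
lemma integral_abs_sidePart_sub_le (hM : 0 ≤ M) (hf : ∃ L, LipschitzOnWith L f (Icc 0 M))
    (hsol₁ : IsEntropySolution M f c₁ ρ₀₁ ρ₁ ξ₁) (hsol₂ : IsEntropySolution M f c₂ ρ₀₂ ρ₂ ξ₂)
    (hsep₁ : IsWellSeparated ρ₁ ξ₁) (hsep₂ : IsWellSeparated ρ₂ ξ₂)
    {σ : ℝ} (hσ : σ = 1 ∨ σ = -1) {t : ℝ} (ht : 0 ≤ t) :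
    ∫ x, |sidePart σ (ξ₁ t) (ρ₁ t) x - sidePart σ (ξ₂ t) (ρ₂ t) x|
      ≤ ∫ x, |sidePart σ (ξ₁ 0) ρ₀₁ x - sidePart σ (ξ₂ 0) ρ₀₂ x| := by
  obtain ⟨L, hL⟩ := hf
  obtain ⟨g, hg, hfg⟩ := hL.extend_real
  obtain ⟨W, w, hW, hw⟩ := hsol₁.exists_isKruzhkovSolution_sidePart hM hg hfg hσ
    (hasStrongTrace_of_isWellSeparated hsep₁ hσ)
  obtain ⟨V, v, hV, hv⟩ := hsol₂.exists_isKruzhkovSolution_sidePart hM hg hfg hσ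
    (hasStrongTrace_of_isWellSeparated hsep₂ hσ)
  have h := hW.norm_sub_le hV (lipschitzWith_mul_of_side hg hσ) ht
  rwa [norm_sub_eq_integral _ _ (hw t ht) (hv t ht),
    norm_sub_eq_integral _ _ ((sidePart_congr_ae hsol₁.initial.symm).trans (hw 0 le_rfl))
      ((sidePart_congr_ae hsol₂.initial.symm).trans (hv 0 le_rfl))] at h

/-- The spatial modulus of continuity of each side does not increase. -/
lemma integral_abs_sidePart_translate_le (hM : 0 ≤ M)
    (hf : ∃ L, LipschitzOnWith L f (Icc 0 M))
    (hsol : IsEntropySolution M f c₁ ρ₀₁ ρ₁ ξ₁) (hsep : IsWellSeparated ρ₁ ξ₁)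
    {σ : ℝ} (hσ : σ = 1 ∨ σ = -1) {t : ℝ} (ht : 0 ≤ t) (h : ℝ) :
    ∫ x, |sidePart σ (ξ₁ t) (ρ₁ t) (x + h) - sidePart σ (ξ₁ t) (ρ₁ t) x|
      ≤ ∫ x, |sidePart σ (ξ₁ 0) ρ₀₁ (x + h) - sidePart σ (ξ₁ 0) ρ₀₁ x| := by
  obtain ⟨L, hL⟩ := hf
  obtain ⟨g, hg, hfg⟩ := hL.extend_real
  obtain ⟨W, w, hW, hw⟩ := hsol.exists_isKruzhkovSolution_sidePart hM hg hfg hσ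
    (hasStrongTrace_of_isWellSeparated hsep hσ)
  have key := (hW.translate h).norm_sub_le hW (lipschitzWith_mul_of_side hg hσ) ht
  have hT : ∀ {u : ℝ → ℝ} {s : ℝ}, u =ᵐ[volume] w s →
      (fun x => u (x + h)) =ᵐ[volume] translateL1 h (w s) := by
    intro u s hu
    have h1 : (fun x => u (x + h)) =ᵐ[volume] fun x => w s (x + h) :=
      (measurePreserving_add_right volume h).quasiMeasurePreserving.ae hu
    exact h1.trans (translateL1_ae_eq h (w s)).symm
  have h0 := (sidePart_congr_ae (σ := σ) (a := ξ₁ 0) hsol.initial.symm).trans (hw 0 le_rfl)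
  rwa [norm_sub_eq_integral _ _ (hT (hw t ht)) (hw t ht),
    norm_sub_eq_integral _ _ (hT h0) h0] at key

/-- Each side contributes the initial variation plus M for the jump created at the initial cut; the
factor 2 counts the sides. -/
lemma totalVariation_le_of_isWellSeparated (hM : 0 ≤ M)
    (hf : ∃ L, LipschitzOnWith L f (Icc 0 M))
    (hsol : IsEntropySolution M f c₁ ρ₀₁ ρ₁ ξ₁) (hsep : IsWellSeparated ρ₁ ξ₁)
    (hρ₀ : ∀ x, ρ₀₁ x ∈ Icc 0 M) (hBV : IsBV ρ₀₁) {t : ℝ} (ht : 0 ≤ t) :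
    totalVariation (ρ₁ t) ≤ ENNReal.ofReal (2 * ((totalVariation ρ₀₁).toReal + M)) := by
  have hi := hsol.integrable t ht
  refine totalVariation_le_of_translate hi fun h hh => ?_
  have hshift : ∀ σ x, sidePart σ (ξ₁ t - h) (fun y => ρ₁ t (y + h)) x
      = sidePart σ (ξ₁ t) (ρ₁ t) (x + h) := fun σ x => by
    have : x + h - ξ₁ t = x - (ξ₁ t - h) := by ring
    simp only [sidePart, indicator, mem_ofPred_eq, this]
  have h1 := integral_abs_sub_le_sidePart (hi.comp_add_right h) hi (ξ₁ t - h) (ξ₁ t)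
  simp only [hshift] at h1
  have h2 : ∀ {σ : ℝ}, (σ = 1 ∨ σ = -1) → _ := fun {σ} hσ =>
    (integral_abs_sidePart_translate_le hM hf hsol hsep hσ ht h).trans
      (integral_abs_sidePart_translate_sub_le hσ hBV hρ₀ (ξ₁ 0) hh.le)
  have h3 := h2 (σ := 1) (Or.inl rfl)
  have h4 := h2 (σ := -1) (Or.inr rfl)
  linarith

lemma integral_abs_sub_le_of_isWellSeparated (hM : 0 ≤ M)
    (hf : ∃ L, LipschitzOnWith L f (Icc 0 M))
    (hsol₁ : IsEntropySolution M f c₁ ρ₀₁ ρ₁ ξ₁) (hsol₂ : IsEntropySolution M f c₂ ρ₀₂ ρ₂ ξ₂)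
    (hsep₁ : IsWellSeparated ρ₁ ξ₁) (hsep₂ : IsWellSeparated ρ₂ ξ₂)
    (hρ₀₁ : ∀ x, 0 ≤ ρ₀₁ x) (hρ₀₂ : ∀ x, 0 ≤ ρ₀₂ x) (hBV : IsBV ρ₀₁) {t : ℝ} (ht : 0 ≤ t) :
    ∫ x, |ρ₁ t x - ρ₂ t x| ≤ (∫ x, |ρ₀₁ x - ρ₀₂ x|)
      + 2 * (|ξ₁ 0 - ξ₂ 0| * (totalVariation ρ₀₁).toReal) := by
  have hi₂ : Integrable ρ₀₂ := (hsol₂.integrable 0 le_rfl).congr hsol₂.initial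
  refine (integral_abs_sub_le_sidePart (hsol₁.integrable t ht) (hsol₂.integrable t ht)
    (ξ₁ t) (ξ₂ t)).trans (le_trans (add_le_add ?_ ?_)
      (sum_integral_sidePart_sub_le hBV hi₂ hρ₀₁ hρ₀₂ (ξ₁ 0) (ξ₂ 0)))
  · exact integral_abs_sidePart_sub_le hM hf hsol₁ hsol₂ hsep₁ hsep₂ (Or.inl rfl) ht
  · exact integral_abs_sidePart_sub_le hM hf hsol₁ hsol₂ hsep₁ hsep₂ (Or.inr rfl) ht

lemma totalVariation_congr_ae {u v : ℝ → ℝ} (h : u =ᵐ[volume] v) :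
    totalVariation u = totalVariation v := by
  have : ∀ ψ : ℝ → ℝ, ∫ x, u x * deriv ψ x = ∫ x, v x * deriv ψ x := fun ψ =>
    integral_congr_ae (by filter_upwards [h] with x hx; rw [hx])
  simp only [totalVariation, this]

lemma eLpNorm_one_eq_ofReal_integral {u : ℝ → ℝ} (hu : Integrable u) :
    eLpNorm u 1 volume = ENNReal.ofReal (∫ x, |u x|) := by
  rw [eLpNorm_one_eq_lintegral_enorm, ← ofReal_integral_norm_eq_lintegral_enorm hu]
  rfl

end

end Hughes

end

/-! ### The stability estimate -/

theorem proposition3p5 (ρmax : ℝ) (hρmax : 0 < ρmax)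
    (f : ℝ → ℝ) (hf_lip : ∃ L, LipschitzOnWith L f (Set.Icc 0 ρmax))
    (hf_nonneg : ∀ r ∈ Set.Icc 0 ρmax, 0 ≤ f r)
    (hf_zero : f 0 = 0) (hf_max : f ρmax = 0)
    (α₁ α₂ : ℝ) (hα₁ : 0 ≤ α₁) (hα₂ : 0 ≤ α₂)
    (ρ₀₁ ρ₀₂ : ℝ → ℝ)
    (h₀₁ : Hughes.IsInitialDatum ρmax ρ₀₁) (h₀₂ : Hughes.IsInitialDatum ρmax ρ₀₂)
    (ρ₁ ρ₂ : ℝ → ℝ → ℝ) (ξ₁ ξ₂ : ℝ → ℝ)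
    (hsol₁ : Hughes.IsEntropySolution ρmax f (Hughes.affineCost α₁) ρ₀₁ ρ₁ ξ₁)
    (hsol₂ : Hughes.IsEntropySolution ρmax f (Hughes.affineCost α₂) ρ₀₂ ρ₂ ξ₂)
    (hsep₁ : Hughes.IsWellSeparated ρ₁ ξ₁) (hsep₂ : Hughes.IsWellSeparated ρ₂ ξ₂)
    (hBV : Hughes.IsBV ρ₀₁) :
    ∀ᵐ t ∂(MeasureTheory.volume.restrict (Set.Ioi (0 : ℝ))),
      Hughes.supVariation ρ₁ t < ⊤ ∧
      MeasureTheory.eLpNorm (ρ₁ t - ρ₂ t) 1 (MeasureTheory.volume.restrict Hughes.corridor) ≤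
        MeasureTheory.eLpNorm (ρ₀₁ - ρ₀₂) 1 (MeasureTheory.volume.restrict Hughes.corridor)
          + 2 * Hughes.supVariation ρ₁ t
            * ENNReal.ofReal
                (|ξ₁ 0 - ξ₂ 0| + ∫ s in (0 : ℝ)..t, |deriv ξ₁ s - deriv ξ₂ s|) := by
  have hM := hρmax.le
  filter_upwards [ae_restrict_mem measurableSet_Ioi] with t ht
  have ht0 : (0 : ℝ) ≤ t := le_of_lt ht
  refine ⟨lt_of_le_of_lt (iSup₂_le fun s hs => Hughes.totalVariation_le_of_isWellSeparated hM hf_lip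
    hsol₁ hsep₁ h₀₁.mem_Icc hBV hs.1) ENNReal.ofReal_lt_top, ?_⟩
  have hi₁ := hBV.1
  have hi₂ : Integrable ρ₀₂ := (hsol₂.integrable 0 le_rfl).congr hsol₂.initial
  have hmain := Hughes.integral_abs_sub_le_of_isWellSeparated hM hf_lip hsol₁ hsol₂ hsep₁ hsep₂
    (fun x => (h₀₁.mem_Icc x).1) (fun x => (h₀₂.mem_Icc x).1) hBV ht0
  have hsupp : Function.support (ρ₀₁ - ρ₀₂) ⊆ Hughes.corridor := fun x hx => by
    by_contra h
    exact hx (by simp [h₀₁.support x h, h₀₂.support x h])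
  -- The supremum includes s = 0, where the solution agrees a.e. with its datum.
  have hTV : Hughes.totalVariation ρ₀₁ ≤ Hughes.supVariation ρ₁ t := by
    rw [← Hughes.totalVariation_congr_ae hsol₁.initial]
    exact le_iSup₂_of_le 0 ⟨le_rfl, ht0⟩ le_rfl
  have hint : 0 ≤ ∫ s in (0 : ℝ)..t, |deriv ξ₁ s - deriv ξ₂ s| :=
    intervalIntegral.integral_nonneg ht0 fun s _ => abs_nonneg _
  rw [eLpNorm_restrict_eq_of_support_subset hsupp,
    Hughes.eLpNorm_one_eq_ofReal_integral (hi₁.sub hi₂)]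
  refine (eLpNorm_mono_measure _ Measure.restrict_le_self).trans ?_
  rw [Hughes.eLpNorm_one_eq_ofReal_integral ((hsol₁.integrable t ht0).sub (hsol₂.integrable t ht0))]
  refine (ENNReal.ofReal_le_ofReal hmain).trans (ENNReal.ofReal_add_le.trans ?_)
  refine add_le_add le_rfl ?_
  rw [ENNReal.ofReal_mul zero_le_two, ENNReal.ofReal_mul (abs_nonneg _),
    ENNReal.ofReal_toReal hBV.2.ne, ENNReal.ofReal_ofNat, mul_comm (ENNReal.ofReal _), ← mul_assoc]
  -- What remains is to enlarge the initial variation to its supremum over time and to add the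
  -- nonnegative integral of the speed difference.
  gcongr
  linarith
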